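/- **Theorem.** Let $G$ be an étale groupoid (not necessarily Hausdorff) whose unit space $X=G^{(0)}$ is compact Hausdorff, with source and range maps $s,r$, and let $\Gamma(G)$ be the set of open bisections $\gamma\subseteq G$, with product $\gamma_1\gamma_2=\{gh : g\in\gamma_1,\ h\in\gamma_2,\ s(g)=r(h)\}$, $\operatorname{supp}\gamma=s(\gamma)$, $\operatorname{im}\gamma=r(\gamma)$ and partial homeomorphism $\psi_\gamma=r|_\gamma\circ(s|_\gamma)^{-1}:\operatorname{supp}\gamma\to\operatorname{im}\gamma$. For a unital C*-algebra $A$, a unital $*$-homomorphism $\iota:C(X)\to A$ and $U\subseteq X$ open put $A_U=\overline{\iota(C_0(U))\,A\,\iota(C_0(U))}$. A *unital $G$-C\*-algebra* is a unital C*-algebra $A$ with an injective unital $*$-homomorphism $\iota:C(X)\to A$ and $*$-isomorphisms $\alpha_\gamma:A_{\operatorname{supp}\gamma}\to A_{\operatorname{im}\gamma}$ $(\gamma\in\Gamma(G))$ such that $\alpha_\gamma(\iota(f))=\iota(f\circ\psi_\gamma^{-1})$ for $f\in C_0(\operatorname{supp}\gamma)$, and such that on $A_{\operatorname{supp}(\gamma_1\gamma_2)}$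 the map $\alpha_{\gamma_2}$ takes values in $A_{\operatorname{supp}\gamma_1\cap\operatorname{im}\gamma_2}$ and $\alpha_{\gamma_1}\circ\alpha_{\gamma_2}=\alpha_{\gamma_1\gamma_2}$. A *$G$-ucp map* $\varphi:A\to B$ is a unital completely positive map with $\varphi\circ\iota_A=\iota_B$ that maps $A_{\operatorname{supp}\gamma}$ to $B_{\operatorname{supp}\gamma}$ and satisfies $\varphi\circ\alpha_\gamma=\beta_\gamma\circ\varphi$ on $A_{\operatorname{supp}\gamma}$ for all $\gamma$. These are the objects and morphisms of the category of unital $G$-C*-algebras. A $G$-ucp map is an *embedding* if it is a complete order embedding. An object $C$ is *injective* if for every embedding $j:A\to B$ and every $G$-ucp map $\varphi:A\to C$ there is a $G$-ucp map $\psi:B\to C$ with $\psi\circ j=\varphi$. An embedding $j:A\to B$ is *rigid* if the only $G$-ucp map $\varphi:B\to B$ with $\varphi\circ j=j$ is $\mathrm{id}_B$, and *essential* if every $G$-ucp map $\varphi:B\to C$ for which $\varphi\circ j$ is an embedding is itself an embedding. A *$G$-injective envelope* of $A$ is an essential embedding $A\to C$ with $C$ injective. $C(X)$ is a unital $G$-C*-algebra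 with $\iota=\mathrm{id}$ and $\alpha_\gamma(f)=f\circ\psi_\gamma^{-1}$, and $\ell^\infty(G)$ is one with $\iota(f)=f\circ r$ and, for $a\in\ell^\infty(G)_{\operatorname{supp}\gamma}$, $\alpha_\gamma(a)(g)=a(u^{-1}g)$ if there is a (necessarily unique) $u\in\gamma$ with $r(u)=r(g)$, and $\alpha_\gamma(a)(g)=0$ otherwise. Then: 1. $\ell^\infty(G)$ is injective in the category of unital $G$-C*-algebras. 2. $C(X)$ has a $G$-injective envelope. 3. Every $G$-injective envelope of $C(X)$ is a rigid extension of $C(X)$ and is a commutative C*-algebra. 4. The $G$-injective envelope is unique: for any two $G$-injective envelopes $i:C(X)\to E$, $i':C(X)\to E'$ there is a $*$-isomorphism $\varphi:E\to E'$ that is an isomorphism in the category of unital $G$-C*-algebras and satisfies $\varphi\circ i=i'$. 5. Consequently the *Hamana boundary* $\partial_{\mathrm H}G$, the spectrum (character space) of a $G$-injective envelope of $C(X)$, exists, is a compact Hausdorff space, is unique up to homeomorphism, and every $G$-injective envelope of $C(X)$ is $*$-isomorphic to $C(\partial_{\mathrm H}G)$. -/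

import Mathlib

universe u

open CategoryTheory Topology
open scoped ENNReal

noncomputable section

/-! ### Étale groupoids

A groupoid is a small category `X` in which all morphisms are invertible. Its space of arrows is
`Quiver.Total X`; an arrow `g : x ⟶ y` has source `g.left = x` and range `g.right = y`. -/

/-- The set of all arrows of the groupoid with set of units `X`. -/
abbrev Arr (X : Type u) [Groupoid.{u} X] : Type u := Quiver.Total X

namespace Arr

variable {X : Type u} [Groupoid.{u} X]

/-- The product `g h` of two arrows, defined if the range of `h` is the source of `g`. -/
def mul (g h : Arr X) (e : h.right = g.left) : Arr X :=
  ⟨h.left, g.right, h.hom ≫ eqToHom e ≫ g.hom⟩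

/-- The inverse arrow. -/
def inv (g : Arr X) : Arr X := ⟨g.right, g.left, Groupoid.inv g.hom⟩

/-- The unit at `x`. -/
def unit (x : X) : Arr X := ⟨x, x, 𝟙 x⟩

@[simp] theorem mul_left (g h : Arr X) (e : h.right = g.left) : (mul g h e).left = h.left := rfl
@[simp] theorem mul_right (g h : Arr X) (e : h.right = g.left) : (mul g h e).right = g.right := rfl
@[simp] theorem inv_left (g : Arr X) : g.inv.left = g.right := rfl
@[simp] theorem inv_right (g : Arr X) : g.inv.right = g.left := rfl

@[simp] theorem inv_inv (g : Arr X) : g.inv.inv = g := by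
  obtain ⟨x, y, g⟩ := g
  simp [inv]

theorem inv_mul_mul (g h : Arr X) (e : h.right = g.left) :
    mul g.inv (mul g h e) rfl = h := by
  obtain ⟨x, y, g⟩ := g
  obtain ⟨z, x', h⟩ := h
  dsimp at e
  subst e
  simp [mul, inv]

theorem mul_inv_mul (g h : Arr X) (e : h.right = g.right) :
    mul g (mul g.inv h e) rfl = h := by
  obtain ⟨x, y, g⟩ := g
  obtain ⟨z, x', h⟩ := h
  dsimp at e
  subst e
  simp [mul, inv]

theorem inv_mul_assoc (u v g : Arr X) (e : v.right = u.left) (e' : g.right = u.right) :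
    mul (mul u v e).inv g e' = mul v.inv (mul u.inv g e') e.symm := by
  obtain ⟨x, y, u⟩ := u
  obtain ⟨z, x', v⟩ := v
  obtain ⟨w, y', g⟩ := g
  dsimp at e e'
  subst e
  subst e'
  simp [mul, inv]

end Arr

/-- An étale groupoid (not necessarily Hausdorff) with space of units `X`: the multiplication and
the inversion are continuous, `X` carries the subspace topology given by `x ↦ 𝟙 x`, and the source
and range maps are local homeomorphisms. -/
class EtaleGroupoid (X : Type u) [Groupoid.{u} X] [TopologicalSpace X]
    [TopologicalSpace (Arr X)] : Prop where
  continuous_mul : Continuous fun p : {p : Arr X × Arr X // p.2.right = p.1.left} =>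
    Arr.mul p.1.1 p.1.2 p.2
  continuous_inv : Continuous (Arr.inv : Arr X → Arr X)
  isEmbedding_unit : IsEmbedding (Arr.unit : X → Arr X)
  isLocalHomeomorph_source : IsLocalHomeomorph (fun g : Arr X => g.left)
  isLocalHomeomorph_range : IsLocalHomeomorph (fun g : Arr X => g.right)

section Bisections

variable (X : Type u) [Groupoid.{u} X] [TopologicalSpace X] [TopologicalSpace (Arr X)]

/-- The open bisections: open sets of arrows on which the source map and the range map are
homeomorphisms onto their images. -/
@[ext] structure OpenBisection where
  carrier : Set (Arr X)
  isOpen : IsOpen carrier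
  isEmbedding_source : IsEmbedding (carrier.domRestrict fun g => g.left)
  isEmbedding_range : IsEmbedding (carrier.domRestrict fun g => g.right)

variable {X}

namespace OpenBisection

instance : Membership (Arr X) (OpenBisection X) := ⟨fun γ g => g ∈ γ.carrier⟩

/-- The support `s(γ)`. -/
def supp (γ : OpenBisection X) : Set X := {x | ∃ g ∈ γ, g.left = x}

/-- The image `r(γ)`. -/
def im (γ : OpenBisection X) : Set X := {y | ∃ g ∈ γ, g.right = y}

theorem eq_of_left_eq (γ : OpenBisection X) {g h : Arr X} (hg : g ∈ γ) (hh : h ∈ γ)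
    (e : g.left = h.left) : g = h :=
  congrArg Subtype.val (@IsEmbedding.injective _ _ _ _ _ γ.isEmbedding_source ⟨g, hg⟩ ⟨h, hh⟩ e)

theorem eq_of_right_eq (γ : OpenBisection X) {g h : Arr X} (hg : g ∈ γ) (hh : h ∈ γ)
    (e : g.right = h.right) : g = h :=
  congrArg Subtype.val (@IsEmbedding.injective _ _ _ _ _ γ.isEmbedding_range ⟨g, hg⟩ ⟨h, hh⟩ e)

/-- The unique arrow of `γ` with range `y ∈ im γ`. -/
def lift (γ : OpenBisection X) (y : γ.im) : Arr X := y.2.choose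

theorem lift_mem (γ : OpenBisection X) (y : γ.im) : γ.lift y ∈ γ := y.2.choose_spec.1

@[simp] theorem lift_right (γ : OpenBisection X) (y : γ.im) : (γ.lift y).right = y :=
  y.2.choose_spec.2

theorem lift_eq (γ : OpenBisection X) {g : Arr X} (hg : g ∈ γ) (y : γ.im) (h : g.right = y) :
    γ.lift y = g :=
  γ.eq_of_right_eq (γ.lift_mem y) hg (by simp [h])

theorem continuous_lift (γ : OpenBisection X) : Continuous γ.lift := by
  have h : Continuous (fun y : γ.im => (⟨γ.lift y, γ.lift_mem y⟩ : γ.carrier)) := by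
    rw [γ.isEmbedding_range.continuous_iff]
    convert continuous_subtype_val (p := fun y => y ∈ γ.im) using 1
    funext y
    exact γ.lift_right y
  exact continuous_subtype_val.comp h

/-- The partial homeomorphism `ψ_{γ*} : im γ → supp γ`, sending `r(g)` to `s(g)` for `g ∈ γ`. -/
def psiStar (γ : OpenBisection X) (y : γ.im) : X := (γ.lift y).left

theorem psiStar_mem (γ : OpenBisection X) (y : γ.im) : γ.psiStar y ∈ γ.supp :=
  ⟨_, γ.lift_mem y, rfl⟩

variable [EtaleGroupoid X]

theorem isOpen_im (γ : OpenBisection X) : IsOpen γ.im :=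
  (EtaleGroupoid.isLocalHomeomorph_range (X := X)).isOpenMap _ γ.isOpen

/-- An open set on which the source and the range map are injective is an open bisection. -/
def ofInjOn (U : Set (Arr X)) (hU : IsOpen U) (hs : U.InjOn fun g => g.left)
    (hr : U.InjOn fun g => g.right) : OpenBisection X where
  carrier := U
  isOpen := hU
  isEmbedding_source :=
    (((EtaleGroupoid.isLocalHomeomorph_source (X := X)).comp
      hU.isOpenEmbedding_subtypeVal.isLocalHomeomorph).isOpenEmbedding_of_injective
        hs.injective).isEmbedding
  isEmbedding_range :=
    (((EtaleGroupoid.isLocalHomeomorph_range (X := X)).comp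
      hU.isOpenEmbedding_subtypeVal.isLocalHomeomorph).isOpenEmbedding_of_injective
        hr.injective).isEmbedding

theorem isOpen_mul (γ₁ γ₂ : OpenBisection X) :
    IsOpen {k | ∃ g ∈ γ₁, ∃ h ∈ γ₂, ∃ e, k = Arr.mul g h e} := by
  have hr : Continuous (fun g : Arr X => g.right) :=
    (EtaleGroupoid.isLocalHomeomorph_range (X := X)).continuous
  let W : Set (Arr X) := {k | k.right ∈ γ₁.im}
  have hW : IsOpen W := γ₁.isOpen_im.preimage hr
  let F : W → Arr X := fun k =>
    Arr.mul (γ₁.lift ⟨k.1.right, k.2⟩).inv k.1 (by simp)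
  let F' : W → {p : Arr X × Arr X // p.2.right = p.1.left} := fun k =>
    ⟨((γ₁.lift ⟨k.1.right, k.2⟩).inv, k.1), by simp⟩
  have hl : Continuous fun k : W => γ₁.lift ⟨k.1.right, k.2⟩ :=
    γ₁.continuous_lift.comp (by fun_prop)
  have hF' : Continuous F' :=
    (((EtaleGroupoid.continuous_inv (X := X)).comp hl).prodMk
        continuous_subtype_val).subtype_mk _
  have hF : Continuous F := (EtaleGroupoid.continuous_mul (X := X)).comp hF'
  have := hW.isOpenMap_subtype_val _ (γ₂.isOpen.preimage hF)
  convert this using 1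
  ext k
  constructor
  · rintro ⟨g, hg, h, hh, e, rfl⟩
    refine ⟨⟨Arr.mul g h e, g, hg, rfl⟩, ?_, rfl⟩
    have : γ₁.lift ⟨g.right, g, hg, rfl⟩ = g := γ₁.lift_eq hg _ rfl
    change Arr.mul (γ₁.lift ⟨g.right, _⟩).inv (Arr.mul g h e) _ ∈ γ₂
    simp only [this, Arr.inv_mul_mul]
    exact hh
  · rintro ⟨k, hk, rfl⟩
    exact ⟨_, γ₁.lift_mem _, _, hk, rfl, (Arr.mul_inv_mul _ _ (by simp)).symm⟩

/-- The product of open bisections: all products `g h` with `g ∈ γ₁`, `h ∈ γ₂`, `s(g) = r(h)`. -/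
instance : Mul (OpenBisection X) where
  mul γ₁ γ₂ := ofInjOn {k | ∃ g ∈ γ₁, ∃ h ∈ γ₂, ∃ e, k = Arr.mul g h e} (isOpen_mul γ₁ γ₂)
    (by
      rintro _ ⟨g, hg, h, hh, e, rfl⟩ _ ⟨g', hg', h', hh', e', rfl⟩ hs
      obtain rfl := γ₂.eq_of_left_eq hh hh' hs
      obtain rfl := γ₁.eq_of_left_eq hg hg' (e.symm.trans e')
      rfl)
    (by
      rintro _ ⟨g, hg, h, hh, e, rfl⟩ _ ⟨g', hg', h', hh', e', rfl⟩ hs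
      obtain rfl := γ₁.eq_of_right_eq hg hg' hs
      obtain rfl := γ₂.eq_of_right_eq hh hh' (e.trans e'.symm)
      rfl)

/-- The inverse `γ* = {g⁻¹ | g ∈ γ}` of an open bisection. -/
instance : Star (OpenBisection X) where
  star γ := ofInjOn {g | g.inv ∈ γ} (γ.isOpen.preimage EtaleGroupoid.continuous_inv)
    (by
      intro g hg h hh e
      have := γ.eq_of_right_eq hg hh e
      rw [← Arr.inv_inv g, this, Arr.inv_inv])
    (by
      intro g hg h hh e
      have := γ.eq_of_left_eq hg hh e
      rw [← Arr.inv_inv g, this, Arr.inv_inv])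

theorem mem_mul {γ₁ γ₂ : OpenBisection X} {k : Arr X} :
    k ∈ γ₁ * γ₂ ↔ ∃ g ∈ γ₁, ∃ h ∈ γ₂, ∃ e, k = Arr.mul g h e := Iff.rfl

theorem mem_star {γ : OpenBisection X} {g : Arr X} : g ∈ star γ ↔ g.inv ∈ γ := Iff.rfl

theorem supp_star (γ : OpenBisection X) : (star γ).supp = γ.im := by
  ext x
  constructor
  · rintro ⟨g, hg, rfl⟩
    exact ⟨g.inv, hg, rfl⟩
  · rintro ⟨g, hg, rfl⟩
    exact ⟨g.inv, by simpa [mem_star] using hg, rfl⟩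

theorem im_star (γ : OpenBisection X) : (star γ).im = γ.supp := by
  ext x
  constructor
  · rintro ⟨g, hg, rfl⟩
    exact ⟨g.inv, hg, rfl⟩
  · rintro ⟨g, hg, rfl⟩
    exact ⟨g.inv, by simpa [mem_star] using hg, rfl⟩

theorem supp_mul_subset (γ₁ γ₂ : OpenBisection X) : (γ₁ * γ₂).supp ⊆ γ₂.supp := by
  rintro _ ⟨_, ⟨g, hg, h, hh, e, rfl⟩, rfl⟩
  exact ⟨h, hh, rfl⟩

theorem lift_mul (γ₁ γ₂ : OpenBisection X) (y : (γ₁ * γ₂).im) (h₁ : (y : X) ∈ γ₁.im)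
    (h₂ : (γ₁.lift ⟨y, h₁⟩).left ∈ γ₂.im) :
    (γ₁ * γ₂).lift y = Arr.mul (γ₁.lift ⟨y, h₁⟩) (γ₂.lift ⟨_, h₂⟩) (by simp) :=
  lift_eq _ (mem_mul.2 ⟨_, γ₁.lift_mem _, _, γ₂.lift_mem _, by simp, rfl⟩) _ (by simp)

theorem mem_im_mul {γ₁ γ₂ : OpenBisection X} {y : X} :
    y ∈ (γ₁ * γ₂).im ↔ ∃ h : y ∈ γ₁.im, (γ₁.lift ⟨y, h⟩).left ∈ γ₂.im := by
  constructor
  · rintro ⟨_, ⟨g, hg, h, hh, e, rfl⟩, rfl⟩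
    have hi : g.right ∈ γ₁.im := ⟨g, hg, rfl⟩
    refine Exists.intro hi ?_
    have : γ₁.lift ⟨g.right, g, hg, rfl⟩ = g := γ₁.lift_eq hg _ rfl
    change ∃ k ∈ γ₂, k.right = (γ₁.lift ⟨g.right, _⟩).left
    exact ⟨h, hh, by rw [this, e]⟩
  · rintro ⟨h₁, h₂⟩
    exact ⟨Arr.mul (γ₁.lift ⟨y, h₁⟩) (γ₂.lift ⟨_, h₂⟩) (by simp),
      mem_mul.2 ⟨_, γ₁.lift_mem ⟨y, h₁⟩, _, γ₂.lift_mem ⟨_, h₂⟩, by simp, rfl⟩, by simp⟩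

theorem lift_star (γ : OpenBisection X) {g : Arr X} (hg : g ∈ γ) (h : g.left ∈ (star γ).im) :
    (star γ).lift ⟨g.left, h⟩ = g.inv :=
  lift_eq _ (by simpa [mem_star] using hg) _ rfl

end OpenBisection

end Bisections

/-! ### Transport of functions on the space of units -/

section Transport

variable {X : Type u} [TopologicalSpace X]

/-- `f ∈ C₀(U)`, for a subset `U` (in practice open) of the compact Hausdorff space `X`: elements
of `C₀(U)` are the continuous functions on `X` that vanish outside `U`. -/
def VanishesOff (U : Set X) (f : C(X, ℂ)) : Prop := ∀ x, x ∉ U → f x = 0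

variable [Groupoid.{u} X] [TopologicalSpace (Arr X)] [EtaleGroupoid X]

open Classical in
/-- The function `f ∘ ψ_{γ*}` on `im γ`, extended by zero to `X`. -/
def transportFun (γ : OpenBisection X) (f : X → ℂ) (y : X) : ℂ :=
  if h : y ∈ γ.im then f (γ.psiStar ⟨y, h⟩) else 0

theorem transportFun_mul (γ₁ γ₂ : OpenBisection X) (f : X → ℂ) :
    transportFun γ₁ (transportFun γ₂ f) = transportFun (γ₁ * γ₂) f := by
  funext y
  by_cases h : y ∈ (γ₁ * γ₂).im
  · obtain ⟨h₁, h₂⟩ := OpenBisection.mem_im_mul.1 h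
    have h₂' : γ₁.psiStar ⟨y, h₁⟩ ∈ γ₂.im := h₂
    rw [transportFun, dif_pos h₁, transportFun, dif_pos h₂', transportFun, dif_pos h]
    simp only [OpenBisection.psiStar]
    rw [OpenBisection.lift_mul γ₁ γ₂ ⟨y, h⟩ h₁ h₂]
    rfl
  · rw [transportFun.eq_1 (γ₁ * γ₂), dif_neg h, transportFun]
    split_ifs with h₁
    · rw [transportFun, dif_neg]
      intro h₂
      exact h (OpenBisection.mem_im_mul.2 ⟨h₁, h₂⟩)
    · rfl

theorem transportFun_star (γ : OpenBisection X) (f : X → ℂ) (hf : ∀ x, x ∉ γ.supp → f x = 0) :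
    transportFun (star γ) (transportFun γ f) = f := by
  funext x
  by_cases h : x ∈ (star γ).im
  · rw [transportFun, dif_pos h]
    have h' := h
    rw [OpenBisection.im_star] at h'
    obtain ⟨g, hg, rfl⟩ := h'
    have hi : g.right ∈ γ.im := ⟨g, hg, rfl⟩
    simp only [OpenBisection.psiStar]
    rw [OpenBisection.lift_star γ hg h, Arr.inv_left, transportFun, dif_pos hi]
    simp only [OpenBisection.psiStar]
    rw [γ.lift_eq hg _ rfl]
  · rw [transportFun, dif_neg h, hf]
    rwa [← OpenBisection.im_star]

theorem transportFun_continuous [CompactSpace X] [T2Space X] (γ : OpenBisection X) (f : C(X, ℂ))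
    (hf : VanishesOff γ.supp f) : Continuous (transportFun γ f) := by
  have hl : Continuous (fun g : Arr X => g.left) :=
    (EtaleGroupoid.isLocalHomeomorph_source (X := X)).continuous
  have hr : Continuous (fun g : Arr X => g.right) :=
    (EtaleGroupoid.isLocalHomeomorph_range (X := X)).continuous
  rw [continuous_iff_continuousAt]
  intro y
  by_cases hy : y ∈ γ.im
  · have h1 : ContinuousOn (transportFun γ f) γ.im := by
      rw [continuousOn_iff_continuous_domRestrict]
      have : γ.im.domRestrict (transportFun γ f) = fun z => f (γ.lift z).left := by
        funext z
        exact dif_pos z.2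
      rw [this]
      exact f.continuous.comp (hl.comp γ.continuous_lift)
    exact h1.continuousAt (γ.isOpen_im.mem_nhds hy)
  · have h0 : transportFun γ f y = 0 := by simp [transportFun, hy]
    rw [ContinuousAt, h0, Metric.tendsto_nhds]
    intro ε hε
    let K : Set X := {x | ε ≤ ‖f x‖}
    have hK : IsCompact K := (isClosed_le continuous_const (by fun_prop)).isCompact
    have hKs : K ⊆ Set.range (γ.carrier.domRestrict fun g => g.left) := by
      intro x hx
      by_contra hc
      have : f x = 0 := hf x (fun ⟨g, hg, e⟩ => hc ⟨⟨g, hg⟩, e⟩)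
      have hx' : ε ≤ ‖f x‖ := hx
      rw [this, norm_zero] at hx'
      linarith
    have hK' := (γ.isEmbedding_source.isInducing.isCompact_preimage_iff hKs).2 hK
    have hC := (hK'.image (hr.comp continuous_subtype_val)).isClosed
    have hyC : y ∉ (fun g : γ.carrier => g.1.right) ''
        ((γ.carrier.domRestrict fun g => g.left) ⁻¹' K) := by
      rintro ⟨g, -, rfl⟩
      exact hy ⟨g.1, g.2, rfl⟩
    filter_upwards [hC.isOpen_compl.mem_nhds hyC] with z hz
    rw [dist_zero_right]
    by_contra hc
    rw [not_lt] at hc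
    by_cases hzi : z ∈ γ.im
    · refine hz ⟨⟨γ.lift ⟨z, hzi⟩, γ.lift_mem _⟩, ?_, γ.lift_right _⟩
      rw [transportFun, dif_pos hzi] at hc
      exact hc
    · simp [transportFun, hzi] at hc
      linarith

variable [CompactSpace X] [T2Space X]

/-- The action of `γ` on the space of units, dually: the map `C₀(supp γ) → C₀(im γ)`,
`f ↦ f ∘ ψ_{γ*}`, where `C₀(supp γ)` and `C₀(im γ)` are regarded as ideals of `C(X)`. -/
def transport (γ : OpenBisection X) (f : C(X, ℂ)) (hf : VanishesOff γ.supp f) : C(X, ℂ) :=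
  ⟨transportFun γ f, transportFun_continuous γ f hf⟩

theorem transport_apply (γ : OpenBisection X) (f : C(X, ℂ)) (hf : VanishesOff γ.supp f) (y : X) :
    transport γ f hf y = transportFun γ f y := rfl

theorem vanishesOff_transport (γ : OpenBisection X) (f : C(X, ℂ)) (hf : VanishesOff γ.supp f) :
    VanishesOff γ.im (transport γ f hf) := fun y hy => by
  simp [transport_apply, transportFun, hy]

theorem vanishesOff_transport_inter (γ₁ γ₂ : OpenBisection X) (f : C(X, ℂ))
    (hf : VanishesOff γ₂.supp f) (hf' : VanishesOff (γ₁ * γ₂).supp f) :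
    VanishesOff (γ₁.supp ∩ γ₂.im) (transport γ₂ f hf) := by
  intro y hy
  by_cases h₂ : y ∈ γ₂.im
  · rw [transport_apply, transportFun, dif_pos h₂]
    apply hf'
    rintro ⟨_, ⟨g, hg, h, hh, e, rfl⟩, he⟩
    apply hy
    have : γ₂.lift ⟨y, h₂⟩ = h := γ₂.eq_of_left_eq (γ₂.lift_mem _) hh he.symm
    refine ⟨⟨g, hg, ?_⟩, h₂⟩
    rw [← e, ← this]
    simp
  · exact vanishesOff_transport γ₂ f hf y h₂

end Transport

/-! ### Unital `G`-C⋆-algebras -/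

section Hereditary

variable {X : Type u} [TopologicalSpace X] {A : Type u} [CStarAlgebra A]

/-- The linear span of `C₀(U) A C₀(U)`. -/
def hereditarySpan (ι : C(X, ℂ) →⋆ₐ[ℂ] A) (U : Set X) : NonUnitalStarSubalgebra ℂ A where
  __ := Submodule.span ℂ {x : A | ∃ (f : C(X, ℂ)) (a : A) (h : C(X, ℂ)),
    VanishesOff U f ∧ VanishesOff U h ∧ x = ι f * a * ι h}
  mul_mem' := by
    intro a b ha hb
    have := Submodule.mul_mem_mul ha hb
    rw [Submodule.span_mul_span] at this
    refine Submodule.span_mono ?_ this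
    rintro _ ⟨_, ⟨f, a, h, hf, hh, rfl⟩, _, ⟨f', a', h', hf', hh', rfl⟩, rfl⟩
    exact ⟨f, a * ι h * (ι f' * a'), h', hf, hh', by simp only [mul_assoc]⟩
  star_mem' := by
    intro a ha
    induction ha using Submodule.span_induction with
    | mem x hx =>
      obtain ⟨f, a, h, hf, hh, rfl⟩ := hx
      refine Submodule.subset_span ⟨star h, star a, star f, fun x hx => ?_, fun x hx => ?_, ?_⟩
      · simp [hh x hx]
      · simp [hf x hx]
      · simp [mul_assoc, map_star]
    | zero => rw [star_zero]; exact Submodule.zero_mem _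
    | add x y _ _ hx hy => rw [star_add]; exact Submodule.add_mem _ hx hy
    | smul c x _ hx => rw [star_smul]; exact Submodule.smul_mem _ _ hx

/-- The hereditary C⋆-subalgebra `A_U`, the closed linear span of `C₀(U) A C₀(U)`, where `C(X)` is
mapped to `A` by `ι`. -/
def hereditary (ι : C(X, ℂ) →⋆ₐ[ℂ] A) (U : Set X) : NonUnitalStarSubalgebra ℂ A :=
  (hereditarySpan ι U).topologicalClosure

/-- The ⋆-isomorphisms `A_U → A_V`. -/
abbrev HereditaryEquiv (ι : C(X, ℂ) →⋆ₐ[ℂ] A) (U V : Set X) : Type u :=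
  hereditary ι U ≃⋆ₐ[ℂ] hereditary ι V

theorem hereditary_mono (ι : C(X, ℂ) →⋆ₐ[ℂ] A) {U V : Set X} (h : U ⊆ V) :
    hereditary ι U ≤ hereditary ι V := by
  refine closure_mono (Submodule.span_mono ?_)
  rintro _ ⟨f, a, h', hf, hh, rfl⟩
  exact ⟨f, a, h', fun x hx => hf x (fun hx' => hx (h hx')),
    fun x hx => hh x (fun hx' => hx (h hx')), rfl⟩

/-- A closed linear condition that holds on `C₀(U) A C₀(U)` holds on `A_U`. -/
theorem hereditary_induction (ι : C(X, ℂ) →⋆ₐ[ℂ] A) (U : Set X) (S : Submodule ℂ A)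
    (hS : IsClosed (S : Set A)) (h : ∀ (f : C(X, ℂ)) (a : A) (h : C(X, ℂ)),
      VanishesOff U f → VanishesOff U h → ι f * a * ι h ∈ S) {a : A} (ha : a ∈ hereditary ι U) :
    a ∈ S := by
  refine closure_minimal (fun x hx => ?_) hS ha
  refine (Submodule.span_le (p := S)).2 ?_ hx
  rintro _ ⟨f, a, h', hf, hh, rfl⟩
  exact h f a h' hf hh

theorem gen_mem_hereditary (ι : C(X, ℂ) →⋆ₐ[ℂ] A) {U : Set X} {f h : C(X, ℂ)}
    (hf : VanishesOff U f) (hh : VanishesOff U h) (a : A) : ι f * a * ι h ∈ hereditary ι U :=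
  subset_closure (Submodule.subset_span ⟨f, a, h, hf, hh, rfl⟩)

/-- `C₀(U) ⊆ A_U`. -/
theorem mem_hereditary [CompactSpace X] (ι : C(X, ℂ) →⋆ₐ[ℂ] A) {U : Set X} {f : C(X, ℂ)}
    (hf : VanishesOff U f) : ι f ∈ hereditary ι U := by
  refine Metric.mem_closure_iff.2 fun ε hε => ?_
  have hpos : ∀ x, 0 < ‖f x‖ ^ 2 + ε ^ 2 := fun x => by positivity
  let h : C(X, ℂ) := ⟨fun x => ((‖f x‖ ^ 2 / (‖f x‖ ^ 2 + ε ^ 2) : ℝ) : ℂ), by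
    refine Complex.continuous_ofReal.comp (Continuous.div (by fun_prop) (by fun_prop) ?_)
    exact fun x => (hpos x).ne'⟩
  have hh : VanishesOff U h := fun x hx => by simp [h, hf x hx]
  refine ⟨ι f * 1 * ι h, Submodule.subset_span ⟨f, 1, h, hf, hh, rfl⟩, ?_⟩
  rw [mul_one, ← map_mul, dist_eq_norm, ← map_sub]
  refine (NonUnitalStarAlgHom.norm_apply_le ι _).trans_lt ?_
  refine lt_of_le_of_lt ((ContinuousMap.norm_le _ (half_pos hε).le).2 fun x => ?_) (half_lt_self hε)
  have : (f - f * h) x = f x * ((ε ^ 2 / (‖f x‖ ^ 2 + ε ^ 2) : ℝ) : ℂ) := by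
    have h1 : ((‖f x‖ : ℂ) ^ 2 + (ε : ℂ) ^ 2) ≠ 0 := by
      exact_mod_cast (hpos x).ne'
    simp only [h, ContinuousMap.sub_apply, ContinuousMap.mul_apply, ContinuousMap.coe_mk]
    push_cast
    field_simp
    ring
  rw [this, norm_mul, Complex.norm_real, Real.norm_of_nonneg (by positivity),
    mul_div_assoc', div_le_iff₀ (hpos x)]
  nlinarith [mul_nonneg hε.le (sq_nonneg (‖f x‖ - ε))]

end Hereditary

section Category

set_option linter.unusedSectionVars false

variable (X : Type u) [Groupoid.{u} X] [TopologicalSpace X] [CompactSpace X] [T2Space X]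
  [TopologicalSpace (Arr X)] [EtaleGroupoid X]

/-- A unital `G`-C⋆-algebra, for an étale groupoid `G` with compact Hausdorff space of units `X`:
a unital C⋆-algebra `A` with an injective unital ⋆-homomorphism `ι : C(X) → A` and ⋆-isomorphisms
`α γ : A_{supp γ} → A_{im γ}`, indexed by the open bisections of `G`, such that `α γ` extends
`f ↦ f ∘ ψ_{γ*}`, and such that on `A_{supp (γ₁ γ₂)}` the map `α γ₂` takes values in
`A_{supp γ₁ ∩ im γ₂}` and `α γ₁ ∘ α γ₂ = α (γ₁ γ₂)`. -/
structure GroupoidCStarAlgebra : Type (u + 1) where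
  carrier : Type u
  [cstar : CStarAlgebra carrier]
  ι : C(X, ℂ) →⋆ₐ[ℂ] carrier
  ι_injective : Function.Injective ι
  α (γ : OpenBisection X) : HereditaryEquiv ι γ.supp γ.im
  α_ι (γ : OpenBisection X) (f : C(X, ℂ)) (hf : VanishesOff γ.supp f) :
    (α γ ⟨ι f, mem_hereditary ι hf⟩ : carrier) = ι (transport γ f hf)
  α_mul (γ₁ γ₂ : OpenBisection X) (a : carrier) (ha : a ∈ hereditary ι (γ₁ * γ₂).supp) :
    ∃ h : (α γ₂ ⟨a, hereditary_mono ι (OpenBisection.supp_mul_subset γ₁ γ₂) ha⟩ : carrier) ∈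
        hereditary ι (γ₁.supp ∩ γ₂.im),
      (α γ₁ ⟨_, hereditary_mono ι Set.inter_subset_left h⟩ : carrier) = α (γ₁ * γ₂) ⟨a, ha⟩

namespace GroupoidCStarAlgebra

variable {X}

instance : CoeSort (GroupoidCStarAlgebra X) (Type u) := ⟨carrier⟩

instance (A : GroupoidCStarAlgebra X) : CStarAlgebra A := A.cstar

/-- The order of a C⋆-algebra. -/
instance (A : GroupoidCStarAlgebra X) : PartialOrder A := CStarAlgebra.spectralOrder A

instance (A : GroupoidCStarAlgebra X) : StarOrderedRing A := CStarAlgebra.spectralOrderedRing A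

/-- A `G`-ucp map: a unital completely positive map that intertwines the embeddings of `C(X)`,
maps `A_{supp γ}` to `B_{supp γ}`, and intertwines the actions of all open bisections. -/
structure Hom (A B : GroupoidCStarAlgebra X) extends CompletelyPositiveMap A B where
  map_one' : toFun 1 = 1
  map_ι' (f : C(X, ℂ)) : toFun (A.ι f) = B.ι f
  equivariant' (γ : OpenBisection X) (a : hereditary A.ι γ.supp) :
    ∃ h : toFun a ∈ hereditary B.ι γ.supp, toFun (A.α γ a) = (B.α γ ⟨toFun a, h⟩ : B)

instance (A B : GroupoidCStarAlgebra X) : FunLike (Hom A B) A B where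
  coe φ := φ.toFun
  coe_injective φ ψ h := by
    rcases φ with ⟨⟨⟨⟨_, _⟩, _⟩, _⟩, _⟩
    rcases ψ with ⟨⟨⟨⟨_, _⟩, _⟩, _⟩, _⟩
    congr

/-- The category of unital `G`-C⋆-algebras and `G`-ucp maps. -/
instance : Category (GroupoidCStarAlgebra X) where
  Hom := Hom
  id A :=
    { toLinearMap := LinearMap.id
      map_cstarMatrix_nonneg' := fun _ _ hM => hM
      map_one' := rfl
      map_ι' := fun _ => rfl
      equivariant' := fun _ a => ⟨a.2, rfl⟩ }
  comp φ ψ :=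
    { toLinearMap := ψ.toLinearMap.comp φ.toLinearMap
      map_cstarMatrix_nonneg' := fun k _ hM =>
        ψ.map_cstarMatrix_nonneg' k _ (φ.map_cstarMatrix_nonneg' k _ hM)
      map_one' := (congrArg ψ.toFun φ.map_one').trans ψ.map_one'
      map_ι' := fun f => (congrArg ψ.toFun (φ.map_ι' f)).trans (ψ.map_ι' f)
      equivariant' := fun γ a => by
        obtain ⟨h, e⟩ := φ.equivariant' γ a
        obtain ⟨h', e'⟩ := ψ.equivariant' γ ⟨_, h⟩
        exact ⟨h', (congrArg ψ.toFun e).trans e'⟩ }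

instance (A B : GroupoidCStarAlgebra X) : FunLike (A ⟶ B) A B :=
  inferInstanceAs (FunLike (Hom A B) A B)

/-- A `G`-ucp map is an embedding if it is a complete order embedding: a matrix over `A` is
positive if and only if its entrywise image is. -/
def IsCompleteOrderEmbedding {A B : GroupoidCStarAlgebra X} (φ : A ⟶ B) : Prop :=
  ∀ (k : ℕ) (M : CStarMatrix (Fin k) (Fin k) A), 0 ≤ M.map φ ↔ 0 ≤ M

/-- `C` is injective in the category of unital `G`-C⋆-algebras: every `G`-ucp map `A ⟶ C` extends
along every embedding `A ⟶ B`. -/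
def IsInjective (C : GroupoidCStarAlgebra X) : Prop :=
  ∀ (A B : GroupoidCStarAlgebra X) (i : A ⟶ B), IsCompleteOrderEmbedding i →
    ∀ φ : A ⟶ C, ∃ ψ : B ⟶ C, i ≫ ψ = φ

/-- The extension `i : A ⟶ B` is rigid. -/
def IsRigid {A B : GroupoidCStarAlgebra X} (i : A ⟶ B) : Prop :=
  IsCompleteOrderEmbedding i ∧ ∀ φ : B ⟶ B, i ≫ φ = i → φ = 𝟙 B

/-- The extension `i : A ⟶ B` is essential. -/
def IsEssential {A B : GroupoidCStarAlgebra X} (i : A ⟶ B) : Prop :=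
  IsCompleteOrderEmbedding i ∧
    ∀ (C : GroupoidCStarAlgebra X) (φ : B ⟶ C),
      IsCompleteOrderEmbedding (i ≫ φ) → IsCompleteOrderEmbedding φ

/-- `i : A ⟶ C` is a `G`-injective envelope of `A`. -/
def IsInjectiveEnvelope {A C : GroupoidCStarAlgebra X} (i : A ⟶ C) : Prop :=
  IsInjective C ∧ IsEssential i

end GroupoidCStarAlgebra

/-! ### The unital `G`-C⋆-algebras `C(X)` and `ℓ^∞(G)` -/

namespace GroupoidCStarAlgebra

variable {X}

theorem mem_hereditary_id {U : Set X} {f : C(X, ℂ)} :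
    f ∈ hereditary (StarAlgHom.id ℂ C(X, ℂ)) U ↔ VanishesOff U f := by
  refine ⟨fun hf x hx => ?_, fun hf => mem_hereditary (StarAlgHom.id ℂ C(X, ℂ)) hf⟩
  let S : Submodule ℂ C(X, ℂ) :=
    { carrier := {f | f x = 0}
      add_mem' := fun {f g} hf hg => by simp_all
      zero_mem' := rfl
      smul_mem' := fun c f hf => by simp_all }
  refine hereditary_induction _ U S ?_ (fun f a h hf _ => ?_) hf
  · exact isClosed_eq (by fun_prop) continuous_const
  · change (f * a * h) x = 0
    simp [hf x hx]

theorem vanishesOff_star {γ : OpenBisection X} {f : C(X, ℂ)} (hf : VanishesOff γ.im f) :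
    VanishesOff (star γ).supp f := by
  rwa [OpenBisection.supp_star]

theorem vanishesOff_transport_star {γ : OpenBisection X} {f : C(X, ℂ)}
    (hf : VanishesOff γ.im f) :
    VanishesOff γ.supp (transport (star γ) f (vanishesOff_star hf)) := by
  have := vanishesOff_transport (star γ) f (vanishesOff_star hf)
  rwa [OpenBisection.im_star] at this

theorem star_star' (γ : OpenBisection X) : star (star γ) = γ := by
  ext g
  change g.inv.inv ∈ γ ↔ g ∈ γ
  rw [Arr.inv_inv]

/-- The action of `γ` on `C(X)`. -/
def unitAction (γ : OpenBisection X) :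
    HereditaryEquiv (StarAlgHom.id ℂ C(X, ℂ)) γ.supp γ.im where
  toFun f := ⟨transport γ f (mem_hereditary_id.1 f.2),
    mem_hereditary_id.2 (vanishesOff_transport γ _ _)⟩
  invFun f := ⟨transport (star γ) f (vanishesOff_star (mem_hereditary_id.1 f.2)),
    mem_hereditary_id.2 (vanishesOff_transport_star (mem_hereditary_id.1 f.2))⟩
  left_inv f := by
    ext x
    exact congrFun (transportFun_star γ f.1 (mem_hereditary_id.1 f.2)) x
  right_inv f := by
    ext x
    have := transportFun_star (star γ) f.1 (vanishesOff_star (mem_hereditary_id.1 f.2))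
    rw [star_star'] at this
    exact congrFun this x
  map_mul' f g := by
    ext x
    simp only [transport, transportFun, NonUnitalStarSubalgebra.coe_mul,
      ContinuousMap.coe_mk, ContinuousMap.mul_apply]
    split_ifs <;> simp
  map_add' f g := by
    ext x
    simp only [transport, transportFun, NonUnitalStarSubalgebra.coe_add,
      ContinuousMap.coe_mk, ContinuousMap.add_apply]
    split_ifs <;> simp
  map_star' f := by
    ext x
    change transportFun γ (star f.1) x = star (transportFun γ f.1 x)
    simp only [transportFun]
    split_ifs <;> simp
  map_smul' c f := by
    ext x
    simp only [transport, transportFun, NonUnitalStarSubalgebra.coe_smul,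
      ContinuousMap.coe_mk, ContinuousMap.smul_apply]
    split_ifs <;> simp

variable (X) in
/-- The unital `G`-C⋆-algebra `C(X)`, with `α γ f = f ∘ ψ_{γ*}`. -/
def unitAlgebra : GroupoidCStarAlgebra X where
  carrier := C(X, ℂ)
  ι := StarAlgHom.id ℂ C(X, ℂ)
  ι_injective := Function.injective_id
  α := unitAction
  α_ι _ _ _ := rfl
  α_mul γ₁ γ₂ f hf := by
    refine ⟨mem_hereditary_id.2 (vanishesOff_transport_inter γ₁ γ₂ f
      (fun x hx => mem_hereditary_id.1 hf x
        (fun hx' => hx (OpenBisection.supp_mul_subset γ₁ γ₂ hx')))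
      (mem_hereditary_id.1 hf)), ?_⟩
    ext x
    exact congrFun (transportFun_mul γ₁ γ₂ f) x

/-- The bounded complex-valued functions on the set of arrows. -/
def BoundedFunctions (X : Type u) [Groupoid.{u} X] : Type u := lp (fun _ : Arr X => ℂ) ∞

instance : CommCStarAlgebra (BoundedFunctions X) :=
  inferInstanceAs (CommCStarAlgebra (lp (fun _ : Arr X => ℂ) ∞))

instance : FunLike (BoundedFunctions X) (Arr X) ℂ where
  coe a := a.1
  coe_injective _ _ h := Subtype.ext h

namespace BoundedFunctions

@[ext] theorem ext {a b : BoundedFunctions X} (h : ∀ g, a g = b g) : a = b := DFunLike.ext _ _ h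

@[simp] theorem add_apply (a b : BoundedFunctions X) (g : Arr X) : (a + b) g = a g + b g := rfl
@[simp] theorem zero_apply (g : Arr X) : (0 : BoundedFunctions X) g = 0 := rfl
@[simp] theorem mul_apply (a b : BoundedFunctions X) (g : Arr X) : (a * b) g = a g * b g := rfl
@[simp] theorem one_apply (g : Arr X) : (1 : BoundedFunctions X) g = 1 := rfl
@[simp] theorem smul_apply (c : ℂ) (a : BoundedFunctions X) (g : Arr X) :
    (c • a) g = c * a g := rfl
@[simp] theorem star_apply (a : BoundedFunctions X) (g : Arr X) : (star a) g = star (a g) := rfl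

theorem norm_apply_le (a : BoundedFunctions X) (g : Arr X) : ‖a g‖ ≤ ‖a‖ :=
  lp.norm_apply_le_norm ENNReal.top_ne_zero (show lp (fun _ : Arr X => ℂ) ∞ from a) g

theorem norm_le {a : BoundedFunctions X} {C : ℝ} (hC : 0 ≤ C) (h : ∀ g, ‖a g‖ ≤ C) : ‖a‖ ≤ C :=
  lp.norm_le_of_forall_le (f := (show lp (fun _ : Arr X => ℂ) ∞ from a)) hC h

end BoundedFunctions

/-- The embedding `f ↦ f ∘ r` of `C(X)` into `ℓ^∞(G)`. -/
def rangePullback : C(X, ℂ) →⋆ₐ[ℂ] BoundedFunctions X where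
  toFun f := ⟨fun g => f g.right, memℓp_infty ⟨‖f‖, by
    rintro _ ⟨g, rfl⟩
    exact f.norm_coe_le_norm _⟩⟩
  map_one' := rfl
  map_mul' _ _ := rfl
  map_zero' := rfl
  map_add' _ _ := rfl
  commutes' _ := rfl
  map_star' _ := rfl

theorem rangePullback_apply (f : C(X, ℂ)) (g : Arr X) : rangePullback f g = f g.right := rfl

open Classical in
/-- Left translation by `γ` of functions on the arrows: `g ↦ a (γ* g)` if `r(g) ∈ im γ`, where
`γ* g = u⁻¹ g` for the unique `u ∈ γ` with `r(u) = r(g)`, and `0` otherwise. -/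
def translateFun (γ : OpenBisection X) (a : Arr X → ℂ) (g : Arr X) : ℂ :=
  if h : g.right ∈ γ.im then a (Arr.mul (γ.lift ⟨g.right, h⟩).inv g (by simp)) else 0

/-- Left translation by `γ` on `ℓ^∞(G)`. -/
def translate (γ : OpenBisection X) : BoundedFunctions X →ₗ[ℂ] BoundedFunctions X where
  toFun a := ⟨translateFun γ a, memℓp_infty ⟨‖a‖, by
    rintro _ ⟨g, rfl⟩
    change ‖translateFun γ a g‖ ≤ ‖a‖
    rw [translateFun]
    split_ifs
    · exact a.norm_apply_le _
    · simp⟩⟩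
  map_add' a b := by
    ext g
    change translateFun γ (fun g => a g + b g) g = translateFun γ a g + translateFun γ b g
    simp only [translateFun]
    split_ifs <;> simp
  map_smul' c a := by
    ext g
    change translateFun γ (fun g => c * a g) g = c * translateFun γ a g
    simp only [translateFun]
    split_ifs <;> simp

theorem translate_apply (γ : OpenBisection X) (a : BoundedFunctions X) (g : Arr X) :
    translate γ a g = translateFun γ a g := rfl

theorem translate_mul (γ : OpenBisection X) (a b : BoundedFunctions X) :
    translate γ (a * b) = translate γ a * translate γ b := by
  ext g
  simp only [BoundedFunctions.mul_apply, translate_apply, translateFun]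
  split_ifs <;> simp

theorem translate_star (γ : OpenBisection X) (a : BoundedFunctions X) :
    translate γ (star a) = star (translate γ a) := by
  ext g
  simp only [BoundedFunctions.star_apply, translate_apply, translateFun]
  split_ifs <;> simp

theorem translate_rangePullback (γ : OpenBisection X) (f : C(X, ℂ))
    (hf : VanishesOff γ.supp f) :
    translate γ (rangePullback f) = rangePullback (transport γ f hf) := by
  ext g
  rw [rangePullback_apply, transport_apply, translate_apply, translateFun, transportFun]
  rfl

theorem continuous_translate (γ : OpenBisection X) :
    Continuous (translate γ : BoundedFunctions X → BoundedFunctions X) := by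
  refine AddMonoidHomClass.continuous_of_bound (translate γ) 1 fun a => ?_
  rw [one_mul]
  refine BoundedFunctions.norm_le (norm_nonneg a) fun g => ?_
  rw [translate_apply, translateFun]
  split_ifs
  · exact a.norm_apply_le _
  · simp

/-- Translation by `γ` maps `ℓ^∞(G)_U` to `ℓ^∞(G)_V` if transport maps `C₀(U)` to `C₀(V)`. -/
theorem translate_mem (γ : OpenBisection X) {U V : Set X} (hU : U ⊆ γ.supp)
    (hV : ∀ (f : C(X, ℂ)) (_ : VanishesOff U f) (hf : VanishesOff γ.supp f),
      VanishesOff V (transport γ f hf)) {a : BoundedFunctions X}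
    (ha : a ∈ hereditary rangePullback U) : translate γ a ∈ hereditary rangePullback V := by
  have hU' : ∀ {f : C(X, ℂ)}, VanishesOff U f → VanishesOff γ.supp f :=
    fun hf x hx => hf x fun hx' => hx (hU hx')
  refine hereditary_induction rangePullback U
    ((hereditary rangePullback V).toSubmodule.comap (translate γ)) ?_ ?_ ha
  · exact isClosed_closure.preimage (continuous_translate γ)
  · intro f a h hf hh
    change translate γ _ ∈ hereditary rangePullback V
    rw [translate_mul, translate_mul, translate_rangePullback γ f (hU' hf),
      translate_rangePullback γ h (hU' hh)]
    exact gen_mem_hereditary _ (hV f hf _) (hV h hh _) _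

theorem apply_eq_zero_of_mem {U : Set X} {a : BoundedFunctions X}
    (ha : a ∈ hereditary rangePullback U) {g : Arr X} (hg : g.right ∉ U) : a g = 0 := by
  let S : Submodule ℂ (BoundedFunctions X) :=
    { carrier := {a | a g = 0}
      add_mem' := fun {f g} hf hg => by simp_all
      zero_mem' := rfl
      smul_mem' := fun c f hf => by simp_all }
  refine hereditary_induction rangePullback U S ?_ (fun f a h hf _ => ?_) ha
  · have : Continuous fun a : BoundedFunctions X => a g := by
      let e : BoundedFunctions X →ₗ[ℂ] ℂ :=
        { toFun := fun a => a g, map_add' := fun _ _ => rfl, map_smul' := fun _ _ => rfl }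
      refine AddMonoidHomClass.continuous_of_bound e 1 fun a => ?_
      rw [one_mul]
      exact a.norm_apply_le g
    exact isClosed_eq this continuous_const
  · change (rangePullback f * a * rangePullback h : BoundedFunctions X) g = 0
    simp [rangePullback_apply, hf _ hg]

theorem translate_translate (γ₁ γ₂ : OpenBisection X) (a : BoundedFunctions X) :
    translate γ₁ (translate γ₂ a) = translate (γ₁ * γ₂) a := by
  ext g
  simp only [translate_apply]
  by_cases h : g.right ∈ (γ₁ * γ₂).im
  · obtain ⟨h₁, h₂⟩ := OpenBisection.mem_im_mul.1 h
    have h₂' : (Arr.mul (γ₁.lift ⟨g.right, h₁⟩).inv g (by simp)).right ∈ γ₂.im := h₂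
    rw [translateFun, dif_pos h₁, translate_apply, translateFun, dif_pos h₂', translateFun,
      dif_pos h]
    simp only [OpenBisection.lift_mul γ₁ γ₂ ⟨g.right, h⟩ h₁ h₂]
    exact congrArg a (Arr.inv_mul_assoc _ _ g _ _).symm
  · rw [translateFun.eq_1 (γ₁ * γ₂), dif_neg h, translateFun]
    split_ifs with h₁
    · rw [translate_apply, translateFun, dif_neg]
      intro h₂
      exact h (OpenBisection.mem_im_mul.2 ⟨h₁, h₂⟩)
    · rfl

theorem translate_star_translate (γ : OpenBisection X) {a : BoundedFunctions X}
    (ha : a ∈ hereditary rangePullback γ.supp) :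
    translate (star γ) (translate γ a) = a := by
  ext g
  rw [translate_apply, translateFun]
  split_ifs with h
  · have h' := h
    rw [OpenBisection.im_star] at h'
    obtain ⟨u, hu, hg⟩ := h'
    have hl : (star γ).lift ⟨g.right, h⟩ = u.inv :=
      OpenBisection.lift_eq _ (by simpa [OpenBisection.mem_star] using hu) _ hg
    have hi : u.right ∈ γ.im := ⟨u, hu, rfl⟩
    simp only [hl, Arr.inv_inv]
    rw [translate_apply, translateFun, dif_pos (show (Arr.mul u g hg.symm).right ∈ γ.im from hi)]
    have hl' : γ.lift ⟨(Arr.mul u g hg.symm).right, hi⟩ = u := γ.lift_eq hu _ rfl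
    simp only [hl', Arr.inv_mul_mul]
  · rw [OpenBisection.im_star] at h
    exact (apply_eq_zero_of_mem ha h).symm

theorem translate_translate_star (γ : OpenBisection X) {a : BoundedFunctions X}
    (ha : a ∈ hereditary rangePullback γ.im) :
    translate γ (translate (star γ) a) = a := by
  have h : a ∈ hereditary rangePullback (star γ).supp := by
    rwa [OpenBisection.supp_star]
  have := translate_star_translate (star γ) h
  rwa [star_star'] at this

theorem translate_mem_im (γ : OpenBisection X) {a : BoundedFunctions X}
    (ha : a ∈ hereditary rangePullback γ.supp) :
    translate γ a ∈ hereditary rangePullback γ.im :=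
  translate_mem γ subset_rfl (fun f _ hf => vanishesOff_transport γ f hf) ha

theorem translate_star_mem_supp (γ : OpenBisection X) {a : BoundedFunctions X}
    (ha : a ∈ hereditary rangePullback γ.im) :
    translate (star γ) a ∈ hereditary rangePullback γ.supp :=
  translate_mem (star γ) (OpenBisection.supp_star γ).ge
    (fun _ hf _ => vanishesOff_transport_star hf) ha

/-- The action of `γ` on `ℓ^∞(G)`. -/
def translateEquiv (γ : OpenBisection X) :
    HereditaryEquiv (rangePullback (X := X)) γ.supp γ.im where
  toFun a := ⟨translate γ a.1, translate_mem_im γ a.2⟩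
  invFun a := ⟨translate (star γ) a.1, translate_star_mem_supp γ a.2⟩
  left_inv a := Subtype.ext (translate_star_translate γ a.2)
  right_inv a := Subtype.ext (translate_translate_star γ a.2)
  map_mul' a b := Subtype.ext (translate_mul γ a.1 b.1)
  map_add' a b := Subtype.ext ((translate γ).map_add' a.1 b.1)
  map_star' a := Subtype.ext (translate_star γ a.1)
  map_smul' c a := Subtype.ext ((translate γ).map_smul' c a.1)

variable (X) in
/-- The unital `G`-C⋆-algebra `ℓ^∞(G)`, with `C(X)` embedded by `f ↦ f ∘ r` and with the action of
open bisections by left translation. -/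
def ellInfty : GroupoidCStarAlgebra X where
  carrier := BoundedFunctions X
  ι := rangePullback
  ι_injective f f' h := by
    ext x
    exact congrArg (fun a : BoundedFunctions X => a (Arr.unit x)) h
  α := translateEquiv
  α_ι γ f hf := translate_rangePullback γ f hf
  α_mul γ₁ γ₂ a ha := ⟨translate_mem γ₂ (OpenBisection.supp_mul_subset γ₁ γ₂)
    (fun f hf hf' => vanishesOff_transport_inter γ₁ γ₂ f hf' hf) ha,
    translate_translate γ₁ γ₂ a⟩

variable (X) in
/-- `Y` is a Hamana boundary of `G`: it is (homeomorphic to) the spectrum of a `G`-injective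
envelope of `C(X)`. -/
def IsHamanaBoundary (Y : Type u) [TopologicalSpace Y] : Prop :=
  ∃ (E : GroupoidCStarAlgebra X) (i : unitAlgebra X ⟶ E),
    IsInjectiveEnvelope i ∧ Nonempty (Y ≃ₜ WeakDual.characterSpace ℂ E)

end GroupoidCStarAlgebra

end Category

end

/-! A `G`-ucp map `B → ℓ^∞(G)` amounts to a family of states `μ x` of `B`, one for each unit `x`,
with `μ x` restricting to evaluation at `x` on `C(X)`. Equivariance forces the value at an arrow
`g`: cut `b` down by a bump function at `r(g)`, translate it back by a bisection through `g`, and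
apply the state at `s(g)`. The cut costs nothing, because a state that is a character on `C(X)` is
modular over `C(X)` (`apply_mul_of_character`). Conversely every such family defines a `G`-ucp map
(`exists_isEquivariantUCP`): no continuity in `x` is required, and positive maps into a commutative
algebra are completely positive. Hence maps into `ℓ^∞(G)` extend unit by unit, by the Riesz
extension theorem, and `ℓ^∞(G)` is injective.

The `G`-ucp endomorphisms of `ℓ^∞(G)` form a compact convex semigroup for pointwise convergence. A
minimal closed one-sided ideal, together with an ergodic averaging argument, yields `e` with `e s e
= e` for every endomorphism `s` (`exists_minimal_idempotent`). The range of `e` with the Choi–Effros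
product `e(xy)` is a commutative unital `G`-C⋆-algebra `E`. It is injective as a retract of
`ℓ^∞(G)`, and `e s e = e` says that its only endomorphism is the identity.

Finally `C(X)` is initial, since a `G`-ucp map intertwines the copies of `C(X)`. So having no
nontrivial endomorphisms gives rigidity, and with injectivity it gives essentiality of `C(X) → E`.
For any other envelope `E'`, injectivity gives maps both ways between `E` and `E'`. One composite is
the identity of `E`, and essentiality makes `E' → E` injective, so both composites are identities.
Mutually inverse ucp maps are multiplicative by Kadison–Schwarz, so `E'` inherits everything from
`E`. -/

noncomputable section

/-! ### Positive functionals -/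

open scoped ComplexOrder

section PositiveFunctional

variable {A : Type*} [CStarAlgebra A] (τ : A →ₗ[ℂ] ℂ)

/-- Positivity of a linear functional, without reference to an order on its domain. -/
def IsPositiveFunctional : Prop := ∀ a, 0 ≤ τ (star a * a)

variable {τ}

namespace IsPositiveFunctional

theorem exists_positiveLinearMap [PartialOrder A] [StarOrderedRing A]
    (hτ : IsPositiveFunctional τ) : ∃ f : A →ₚ[ℂ] ℂ, ∀ a, f a = τ a := by
  refine ⟨PositiveLinearMap.mk₀ τ fun a ha => ?_, fun _ => rfl⟩
  obtain ⟨b, rfl⟩ := CStarAlgebra.nonneg_iff_eq_star_mul_self.1 ha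
  exact hτ b

theorem apply_star (hτ : IsPositiveFunctional τ) (a : A) : τ (star a) = star (τ a) := by
  let _ := CStarAlgebra.spectralOrder A
  have := CStarAlgebra.spectralOrderedRing A
  obtain ⟨f, hf⟩ := hτ.exists_positiveLinearMap
  rw [← hf, ← hf, StarHomClass.map_star]

/-- Cauchy–Schwarz for the GNS form `(a, b) ↦ τ (a⋆ b)`. -/
theorem norm_sq_le (hτ : IsPositiveFunctional τ) (a b : A) :
    ‖τ (star a * b)‖ ^ 2 ≤ (τ (star a * a)).re * (τ (star b * b)).re := by
  let _ := CStarAlgebra.spectralOrder A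
  have := CStarAlgebra.spectralOrderedRing A
  obtain ⟨f, hf⟩ := hτ.exists_positiveLinearMap
  have h := norm_inner_le_norm (𝕜 := ℂ) (f.toPreGNS a) (f.toPreGNS b)
  have ha := f.preGNS_norm_sq (f.toPreGNS a)
  have hb := f.preGNS_norm_sq (f.toPreGNS b)
  rw [f.preGNS_inner_def] at h
  simp only [f.ofPreGNS_toPreGNS, hf] at h ha hb
  rw [← ha, ← hb, ← Complex.ofReal_pow, ← Complex.ofReal_pow, Complex.ofReal_re,
    Complex.ofReal_re, ← mul_pow]
  gcongr

/-- Null vectors of the GNS form are orthogonal to everything. Both modularity over `C(X)` and the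
associativity of the Choi–Effros product come from this. -/
theorem apply_star_mul_eq_zero (hτ : IsPositiveFunctional τ) {a : A} (ha : τ (star a * a) = 0)
    (b : A) : τ (star a * b) = 0 := by
  have := hτ.norm_sq_le a b
  rw [ha, Complex.zero_re, zero_mul] at this
  exact norm_eq_zero.1 (pow_eq_zero_iff two_ne_zero |>.1 (le_antisymm this (sq_nonneg _)))

/-- By Cauchy–Schwarz against `1`, `|τ a|² ≤ τ (a⋆ a) ≤ ‖a⋆ a‖ = ‖a‖²`. -/
theorem norm_le (hτ : IsPositiveFunctional τ) (h1 : τ 1 = 1) (a : A) : ‖τ a‖ ≤ ‖a‖ := by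
  let _ := CStarAlgebra.spectralOrder A
  have := CStarAlgebra.spectralOrderedRing A
  obtain ⟨f, hf⟩ := hτ.exists_positiveLinearMap
  have h := hτ.norm_sq_le 1 a
  simp only [star_one, one_mul, h1, Complex.one_re] at h
  have h' : ‖f (star a * a)‖ ≤ ‖f 1‖ * ‖star a * a‖ :=
    f.norm_apply_le_of_nonneg _ (star_mul_self_nonneg a)
  rw [hf, hf, h1, norm_one, one_mul, CStarRing.norm_star_mul_self] at h'
  have := Complex.re_le_norm (τ (star a * a))
  exact abs_le_of_sq_le_sq' (by nlinarith) (norm_nonneg a) |>.2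

/-- The Kadison–Schwarz inequality for states. -/
theorem star_apply_mul_apply_le (hτ : IsPositiveFunctional τ) (h1 : τ 1 = 1) (a : A) :
    star (τ a) * τ a ≤ τ (star a * a) := by
  have h := hτ.norm_sq_le 1 a
  simp only [star_one, one_mul, h1, Complex.one_re] at h
  have h0 := hτ a
  rw [Complex.le_def] at h0 ⊢
  have : star (τ a) * τ a = ((‖τ a‖ ^ 2 : ℝ) : ℂ) := by
    rw [Complex.star_def, ← Complex.normSq_eq_conj_mul_self, Complex.normSq_eq_norm_sq]
  rw [this, Complex.ofReal_re, Complex.ofReal_im]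
  exact ⟨h, h0.2⟩

/-- A positive functional whose restriction to a subalgebra is a character is modular over that
subalgebra. -/
theorem apply_mul_of_character {D : Type*} [CStarAlgebra D] {π : D →⋆ₐ[ℂ] A} {χ : D →⋆ₐ[ℂ] ℂ}
    (hτ : IsPositiveFunctional τ) (h : ∀ d, τ (π d) = χ d) (d : D) (a : A) :
    τ (π d * a) = χ d * τ a := by
  -- The element `π d⋆ - conj (χ d)` is a null vector of `τ`: on the image of `π` the functional is
  -- the multiplicative `χ`, which kills `d⋆ - conj (χ d)`.
  have h0 : τ (star (π (star d) - algebraMap ℂ A (star (χ d))) *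
      (π (star d) - algebraMap ℂ A (star (χ d)))) = 0 := by
    have e : π (star d) - algebraMap ℂ A (star (χ d))
        = π (star d - algebraMap ℂ D (star (χ d))) := by
      rw [map_sub, AlgHomClass.commutes π]
    rw [e, ← StarHomClass.map_star, ← map_mul, h, map_mul, map_sub χ, AlgHomClass.commutes χ]
    simp [StarHomClass.map_star]
  have := hτ.apply_star_mul_eq_zero h0 a
  rw [star_sub, ← StarHomClass.map_star, star_star, sub_mul, map_sub, sub_eq_zero] at this
  rw [this, ← algebraMap_star_comm, star_star, ← Algebra.smul_def, map_smul, smul_eq_mul]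

theorem apply_mul_of_character' {D : Type*} [CStarAlgebra D] {π : D →⋆ₐ[ℂ] A} {χ : D →⋆ₐ[ℂ] ℂ}
    (hτ : IsPositiveFunctional τ) (h : ∀ d, τ (π d) = χ d) (a : A) (d : D) :
    τ (a * π d) = τ a * χ d := by
  have := hτ.apply_mul_of_character h (star d) (star a)
  rw [StarHomClass.map_star, ← star_mul, hτ.apply_star, hτ.apply_star, StarHomClass.map_star,
    ← star_mul'] at this
  rw [star_injective this, mul_comm]

end IsPositiveFunctional

end PositiveFunctional

/-! ### Positivity in matrix algebras -/

section Positivity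

/-- Positivity may be tested on a jointly injective family of ⋆-homomorphisms. -/
theorem nonneg_of_forall_starAlgHom {A I : Type*} {B : I → Type*} [NonUnitalCStarAlgebra A]
    [PartialOrder A] [StarOrderedRing A] [∀ i, NonUnitalCStarAlgebra (B i)]
    [∀ i, PartialOrder (B i)] [∀ i, StarOrderedRing (B i)] (π : ∀ i, A →⋆ₙₐ[ℂ] B i)
    (hπ : ∀ a, (∀ i, π i a = 0) → a = 0) {a : A} (ha : ∀ i, 0 ≤ π i a) : 0 ≤ a := by
  have hsa : IsSelfAdjoint a := by
    rw [IsSelfAdjoint, ← sub_eq_zero]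
    refine hπ _ fun i => ?_
    rw [map_sub, map_star, (IsSelfAdjoint.of_nonneg (ha i)).star_eq, sub_self]
  -- The functional calculus commutes with each `π i`, so the negative part of `a` is sent to that
  -- of `π i a`, which is zero.
  rw [← CFC.negPart_eq_zero_iff a hsa]
  refine hπ _ fun i => ?_
  have hi := (CFC.negPart_eq_zero_iff (π i a) (.of_nonneg (ha i))).2 (ha i)
  rw [CFC.negPart_def] at hi ⊢
  rw [← hi]
  have hc : Continuous (π i) := by
    refine AddMonoidHomClass.continuous_of_bound (π i) 1 fun x => ?_
    rw [one_mul]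
    exact NonUnitalStarAlgHom.norm_apply_le (π i) x
  exact NonUnitalStarAlgHomClass.map_cfcₙ ((π i).restrictScalars ℝ) _ a (by fun_prop) (by simp)
    hc hsa (.of_nonneg (ha i))


theorem exists_eq_star_mul_self {A : Type*} [NonUnitalCStarAlgebra A] [PartialOrder A]
    [StarOrderedRing A] {a : A} (ha : 0 ≤ a) : ∃ b, a = star b * b :=
  CStarAlgebra.nonneg_iff_eq_star_mul_self.1 ha

variable {k : ℕ}

/-- If `M = N⋆ N`, the sum is `∑ l, (N c)_l⋆ (N c)_l`. -/
theorem CStarMatrix.sum_star_mul_mul_nonneg {A : Type*} [CStarAlgebra A] [PartialOrder A]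
    [StarOrderedRing A] {M : CStarMatrix (Fin k) (Fin k) A} (hM : 0 ≤ M) (c : Fin k → A) :
    0 ≤ ∑ i, ∑ j, star (c i) * M i j * c j := by
  obtain ⟨N, rfl⟩ : ∃ N : CStarMatrix (Fin k) (Fin k) A, M = star N * N :=
    exists_eq_star_mul_self hM
  have : ∑ i, ∑ j, star (c i) * (star N * N) i j * c j
      = ∑ l, star (∑ i, N l i * c i) * ∑ j, N l j * c j := by
    calc ∑ i, ∑ j, star (c i) * (star N * N) i j * c j
        = ∑ i, ∑ j, ∑ l, star (c i) * star (N l i) * (N l j * c j) := by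
          simp only [CStarMatrix.mul_apply, CStarMatrix.star_apply, Finset.sum_mul,
            Finset.mul_sum, mul_assoc]
      _ = ∑ l, ∑ i, ∑ j, star (c i) * star (N l i) * (N l j * c j) := by
          exact (Finset.sum_congr rfl fun i _ => Finset.sum_comm).trans Finset.sum_comm
      _ = _ := by
          simp only [star_sum, star_mul, Finset.sum_mul_sum]
  rw [this]
  exact Finset.sum_nonneg fun l _ => star_mul_self_nonneg _

/-- The hypothesis makes the scalar matrix positive semidefinite, hence of the form `N⋆ N`. This
factorisation is algebraic, so it carries over from `Matrix` to `CStarMatrix`. -/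
theorem CStarMatrix.nonneg_of_forall_sum {M : CStarMatrix (Fin k) (Fin k) ℂ}
    (hM : ∀ c : Fin k → ℂ, 0 ≤ ∑ i, ∑ j, star (c i) * M i j * c j) : 0 ≤ M := by
  have hps : Matrix.PosSemidef (CStarMatrix.ofMatrix.symm M) := by
    rw [← Matrix.isPositive_toEuclideanLin_iff, LinearMap.isPositive_iff_complex]
    intro x
    have h := hM x.ofLp
    have e : inner ℂ (Matrix.toEuclideanLin (CStarMatrix.ofMatrix.symm M) x) x =
        star (∑ i, ∑ j, star (x.ofLp i) * M i j * x.ofLp j) := by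
      rw [EuclideanSpace.inner_eq_star_dotProduct, Matrix.ofLp_toLpLin, Matrix.toLin'_apply,
        ← star_star x.ofLp, Matrix.dotProduct_star, star_star]
      simp only [dotProduct, Matrix.mulVec, Finset.sum_mul, star_sum, star_mul', star_star,
        Pi.star_apply, CStarMatrix.ofMatrix_symm_apply]
      exact Finset.sum_congr rfl fun i _ => Finset.sum_congr rfl fun j _ => by ring
    rw [e, h.isSelfAdjoint.star_eq]
    exact ⟨(Complex.ext rfl (by simpa using h.2)), h.1⟩
  open scoped MatrixOrder Matrix.Norms.L2Operator in
  obtain ⟨N, hN⟩ : ∃ N : Matrix (Fin k) (Fin k) ℂ, CStarMatrix.ofMatrix.symm M = star N * N :=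
    CStarAlgebra.nonneg_iff_eq_star_mul_self.1 hps.nonneg
  have : M = star (CStarMatrix.ofMatrix N) * CStarMatrix.ofMatrix N := hN
  rw [this]
  exact star_mul_self_nonneg _

theorem characterSpace_separates {B : Type*} [CommCStarAlgebra B] {b : B}
    (h : ∀ χ : WeakDual.characterSpace ℂ B, χ b = 0) : b = 0 := by
  apply (gelfandStarTransform B).injective
  rw [map_zero]
  ext χ
  exact h χ

/-- A positive map into a commutative C⋆-algebra is completely positive. -/
theorem map_cstarMatrix_nonneg_of_commute {A B : Type*} [CStarAlgebra A] [PartialOrder A]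
    [StarOrderedRing A] [CommCStarAlgebra B] [PartialOrder B] [StarOrderedRing B] (φ : A →ₗ[ℂ] B)
    (hφ : ∀ a, 0 ≤ φ (star a * a)) {M : CStarMatrix (Fin k) (Fin k) A} (hM : 0 ≤ M) :
    0 ≤ M.map φ := by
  -- Applying the characters of `B` entrywise reduces the claim to scalar matrices.
  refine nonneg_of_forall_starAlgHom (I := WeakDual.characterSpace ℂ B)
    (B := fun _ => CStarMatrix (Fin k) (Fin k) ℂ)
    (fun χ => CStarMatrix.mapₙₐ
      (StarAlgHomClass.toStarAlgHom χ : B →⋆ₐ[ℂ] ℂ).toNonUnitalStarAlgHom)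
    (fun N hN => ?_) fun χ => ?_
  · ext i j
    refine characterSpace_separates fun χ => ?_
    exact congrFun (congrFun (hN χ) i) j
  · refine CStarMatrix.nonneg_of_forall_sum fun c => ?_
    -- The scalar quadratic form of `χ ∘ φ` on `M` is `χ ∘ φ` of the quadratic form of `M` itself, a
    -- positive element `b⋆ b` of `A`.
    have h := CStarMatrix.sum_star_mul_mul_nonneg hM fun i => algebraMap ℂ A (c i)
    obtain ⟨b, hb⟩ := exists_eq_star_mul_self h
    have h2 : 0 ≤ χ (φ (star b * b)) := by
      obtain ⟨d, hd⟩ := exists_eq_star_mul_self (hφ b)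
      rw [hd, map_mul, map_star]
      exact star_mul_self_nonneg _
    rw [← hb] at h2
    convert h2
    simp only [map_sum]
    refine Finset.sum_congr rfl fun i _ => Finset.sum_congr rfl fun j _ => ?_
    rw [← algebraMap_star_comm, mul_assoc, ← Algebra.commutes, ← Algebra.smul_def,
      ← Algebra.smul_def]
    simp [CStarMatrix.map_apply, CStarMatrix.mapₙₐ]
    ring

end Positivity

/-! ### Kadison–Schwarz inequality and complete order isomorphisms -/

section KadisonSchwarz

variable {A B : Type*} [CStarAlgebra A] [PartialOrder A] [StarOrderedRing A] [CStarAlgebra B]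
  [PartialOrder B] [StarOrderedRing B]

open scoped CStarAlgebra

theorem CompletelyPositiveMap.apply_star (φ : A →CP B) (a : A) : φ (star a) = star (φ a) :=
  map_star φ a

/-- Two-positivity suffices: the matrix with rows `(1, a)` and `(a⋆, a⋆ a)` is positive, and testing
its image on the vector `(-φ a, 1)` leaves `φ (a⋆ a) - (φ a)⋆ φ a`. -/
theorem CompletelyPositiveMap.star_apply_mul_apply_le (φ : A →CP B) (h1 : φ 1 = 1) (a : A) :
    star (φ a) * φ a ≤ φ (star a * a) := by
  let V : CStarMatrix (Fin 2) (Fin 2) A := CStarMatrix.ofMatrix !![1, a; 0, 0]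
  have h0 : 0 ≤ star V * V := star_mul_self_nonneg V
  have h2 := CStarMatrix.sum_star_mul_mul_nonneg (φ.map_cstarMatrix_nonneg' 2 _ h0)
    ![- φ a, 1]
  rw [← sub_nonneg]
  convert h2 using 1
  have e (b : A) : φ.toLinearMap b = φ b := rfl
  simp [Fin.sum_univ_two, CStarMatrix.map_apply, CStarMatrix.mul_apply, CStarMatrix.star_apply, V,
    e, h1, φ.apply_star]
  abel

/-- A sesquilinear map that vanishes on the diagonal vanishes. -/
theorem eq_zero_of_diagonal {V W : Type*} [AddCommGroup V] [Module ℂ V] [AddCommGroup W]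
    [Module ℂ W] (D : V →ₗ⋆[ℂ] V →ₗ[ℂ] W) (h : ∀ x, D x x = 0) (x y : V) : D x y = 0 := by
  have h1 : D x y + D y x = 0 := by simpa [h, add_comm] using h (x + y)
  have h2 : D x y - D y x = 0 := by
    have : Complex.I • (D x y - D y x) = 0 := by
      simpa [h, smul_sub, sub_eq_add_neg, add_comm] using h (x + Complex.I • y)
    exact (smul_eq_zero.1 this).resolve_left Complex.I_ne_zero
  have h3 : (2 : ℂ) • D x y = 0 := by
    rw [← sub_eq_zero.1 h2] at h1
    rwa [two_smul]
  simpa using h3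

/-- Mutually inverse unital completely positive maps are multiplicative. -/
theorem CompletelyPositiveMap.apply_mul_of_inverse (φ : A →CP B) (ψ : B →CP A) (hφ : φ 1 = 1)
    (hψ : ψ 1 = 1) (h : ∀ a, ψ (φ a) = a) (h' : ∀ b, φ (ψ b) = b) (a b : A) :
    φ (a * b) = φ a * φ b := by
  -- Kadison–Schwarz for `ψ` at `φ a`, pushed forward by `φ`, reverses Kadison–Schwarz for `φ`.
  -- Polarisation then gives all products.
  have key (a : A) : φ (star a * a) = star (φ a) * φ a := by
    refine le_antisymm ?_ (φ.star_apply_mul_apply_le hφ a)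
    have := ψ.star_apply_mul_apply_le hψ (φ a)
    rw [h] at this
    have := OrderHomClass.mono φ this
    rwa [h'] at this
  let D : A →ₗ⋆[ℂ] A →ₗ[ℂ] B := LinearMap.mk₂'ₛₗ _ _
    (fun x y => φ (star x * y) - star (φ x) * φ y)
    (by intros; simp [add_mul]; abel) (by intros; simp [smul_sub])
    (by intros; simp [mul_add]; abel) (by intros; simp [smul_sub])
  have := eq_zero_of_diagonal D (fun x => by simp [D, key]) (star a) b
  simpa [D, sub_eq_zero, φ.apply_star] using this

end KadisonSchwarz

/-! ### Extension of positive functionals -/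

section Extension

variable {A B : Type*} [CStarAlgebra A] [PartialOrder A] [StarOrderedRing A] [CStarAlgebra B]
  [PartialOrder B] [StarOrderedRing B]

/-- On self-adjoint elements `τ ∘ j⁻¹` is positive on the range of `j`, because `j` reflects the
order. This range contains the order unit `1`, so the Riesz extension theorem applies. The real
functional obtained is then complexified. -/
theorem exists_isPositiveFunctional_extension (j : A →ₗ[ℂ] B) (h1 : j 1 = 1)
    (hstar : ∀ a, j (star a) = star (j a)) (hj : ∀ a, 0 ≤ j a ↔ 0 ≤ a) {τ : A →ₗ[ℂ] ℂ}
    (hτ : IsPositiveFunctional τ) :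
    ∃ σ : B →ₗ[ℂ] ℂ, IsPositiveFunctional σ ∧ ∀ a, σ (j a) = τ a := by
  have hτ' (a : A) (ha : 0 ≤ a) : 0 ≤ τ a := by
    obtain ⟨b, rfl⟩ := exists_eq_star_mul_self ha
    exact hτ b
  have hinj : Function.Injective j := by
    rw [injective_iff_map_eq_zero]
    intro a ha
    exact le_antisymm (neg_nonneg.1 ((hj _).1 (by simp [ha]))) ((hj _).1 (by simp [ha]))
  let js : selfAdjoint A →ₗ[ℝ] selfAdjoint B :=
    { toFun := fun a => ⟨j a, by rw [selfAdjoint.mem_iff, ← hstar, a.2.star_eq]⟩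
      map_add' := fun a b => Subtype.ext (map_add j _ _)
      map_smul' := fun c a => Subtype.ext (by
        change j ((c : ℝ) • (a : A)) = c • j a
        rw [← Complex.coe_smul, map_smul, Complex.coe_smul]) }
  have hjs : Function.Injective js := fun a b h => Subtype.ext (hinj (congrArg Subtype.val h))
  let e := LinearEquiv.ofInjective js hjs
  let τs : selfAdjoint A →ₗ[ℝ] ℝ := Complex.reLm ∘ₗ τ.restrictScalars ℝ ∘ₗ
    (selfAdjoint.submodule ℝ A).subtype
  let f : selfAdjoint B →ₗ.[ℝ] ℝ := ⟨LinearMap.range js, τs ∘ₗ e.symm.toLinearMap⟩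
  have hf (a : selfAdjoint A) : f ⟨js a, a, rfl⟩ = (τ a).re := by
    have : e.symm ⟨js a, a, rfl⟩ = a := (e.symm_apply_eq).2 rfl
    change τs (e.symm ⟨js a, a, rfl⟩) = _
    rw [this]
    rfl
  let s : PointedCone ℝ (selfAdjoint B) :=
    { carrier := {b | 0 ≤ (b : B)}
      add_mem' := fun ha hb => add_nonneg ha hb
      zero_mem' := le_rfl
      smul_mem' := fun c b hb => smul_nonneg c.2 hb }
  obtain ⟨g, hg, hgs⟩ := riesz_extension s f
    (by
      rintro ⟨_, a, rfl⟩ ha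
      rw [hf]
      exact (Complex.le_def.1 (hτ' _ ((hj _).1 ha))).1)
    (fun y => by
      -- Cofinality of the range: `‖y‖ · 1 + y ≥ 0` for self-adjoint `y`.
      refine ⟨⟨js ⟨algebraMap ℝ A ‖y‖, ?_⟩, _, rfl⟩, ?_⟩
      · exact IsSelfAdjoint.algebraMap A (.all _)
      · change 0 ≤ j (algebraMap ℝ A ‖y‖) + y
        have : j (algebraMap ℝ A ‖y‖) = algebraMap ℝ B ‖(y : B)‖ := by
          rw [Algebra.algebraMap_eq_smul_one, Algebra.algebraMap_eq_smul_one, ← Complex.coe_smul,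
            map_smul, h1, Complex.coe_smul]
          rfl
        rw [this]
        have := IsSelfAdjoint.neg_algebraMap_norm_le_self y.2
        rwa [neg_le_iff_add_nonneg, add_comm] at this)
  let σ : B →ₗ[ℂ] ℂ :=
    { toFun := fun b => g (realPart b) + Complex.I * g (imaginaryPart b)
      map_add' := fun a b => by
        simp only [map_add, Complex.ofReal_add]
        ring
      map_smul' := fun c a => by
        simp only [realPart_smul, imaginaryPart_smul, map_add, map_sub, map_smul]
        apply Complex.ext <;> simp }
  have hσ (b : B) (hb : IsSelfAdjoint b) : σ b = g ⟨b, hb⟩ := by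
    change (g (realPart b) : ℂ) + Complex.I * g (imaginaryPart b) = _
    have hr : realPart b = ⟨b, hb⟩ := Subtype.ext hb.coe_realPart
    simp [hr, hb.imaginaryPart]
  refine ⟨σ, fun b => ?_, fun a => ?_⟩
  · rw [hσ _ (.star_mul_self b)]
    exact_mod_cast hgs _ (star_mul_self_nonneg b)
  · have hsa (a : A) (ha : IsSelfAdjoint a) : σ (j a) = τ a := by
      rw [hσ _ (by rw [IsSelfAdjoint, ← hstar, ha.star_eq])]
      have := hg ⟨js ⟨a, ha⟩, _, rfl⟩
      rw [hf] at this
      refine (congrArg Complex.ofReal this).trans ?_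
      have h' := hτ.apply_star a
      rw [ha.star_eq] at h'
      exact Complex.conj_eq_iff_re.1 h'.symm
    rw [← realPart_add_I_smul_imaginaryPart a]
    simp only [map_add, map_smul, hsa _ (realPart a).2, hsa _ (imaginaryPart a).2]

end Extension

/-! ### Bisections -/

namespace Arr

variable {X : Type u} [Groupoid.{u} X]

theorem mul_unit (g : Arr X) : mul g (unit g.left) rfl = g := by
  obtain ⟨x, y, g⟩ := g
  simp [mul, unit]

theorem inv_mul_self (g : Arr X) : mul g.inv g rfl = unit g.left := by
  obtain ⟨x, y, g⟩ := g
  simp [mul, unit, inv]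

end Arr

namespace OpenBisection

variable {X : Type u} [Groupoid.{u} X] [TopologicalSpace X] [TopologicalSpace (Arr X)]
  [EtaleGroupoid X]

/-- Source and range are each injective on a neighbourhood of `g`; intersect the two. Thus the open
bisections cover `G`. -/
theorem exists_mem (g : Arr X) : ∃ γ : OpenBisection X, g ∈ γ := by
  obtain ⟨e, he, hs⟩ := EtaleGroupoid.isLocalHomeomorph_source (X := X) g
  obtain ⟨e', he', hr⟩ := EtaleGroupoid.isLocalHomeomorph_range (X := X) g
  refine ⟨ofInjOn (e.source ∩ e'.source) (e.open_source.inter e'.open_source) ?_ ?_, he, he'⟩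
  · rw [hs]
    exact e.injOn.mono Set.inter_subset_left
  · rw [hr]
    exact e'.injOn.mono Set.inter_subset_right

/-- The intersection of two open bisections. -/
def inter (γ γ' : OpenBisection X) : OpenBisection X :=
  ofInjOn (γ.carrier ∩ γ'.carrier) (γ.isOpen.inter γ'.isOpen)
    (fun _ hg _ hh e => γ.eq_of_left_eq hg.1 hh.1 e)
    (fun _ hg _ hh e => γ.eq_of_right_eq hg.1 hh.1 e)

omit [EtaleGroupoid X] in
theorem supp_mono {γ γ' : OpenBisection X} (h : γ.carrier ⊆ γ'.carrier) : γ.supp ⊆ γ'.supp :=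
  fun _ ⟨g, hg, e⟩ => ⟨g, h hg, e⟩

omit [EtaleGroupoid X] in
theorem ext_mem {γ γ' : OpenBisection X} (h : ∀ g, g ∈ γ ↔ g ∈ γ') : γ = γ' :=
  OpenBisection.ext (Set.ext h)

theorem mem_star_mul_self {γ : OpenBisection X} {k : Arr X} :
    k ∈ star γ * γ ↔ ∃ x ∈ γ.supp, k = Arr.unit x := by
  constructor
  · rintro ⟨g, hg, h, hh, e, rfl⟩
    have : g.inv = h := γ.eq_of_right_eq hg hh e.symm
    subst this
    refine ⟨_, ⟨_, hh, rfl⟩, ?_⟩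
    rw [← Arr.inv_mul_self]
    simp
  · rintro ⟨_, ⟨g, hg, rfl⟩, rfl⟩
    exact ⟨g.inv, by simpa [mem_star] using hg, g, hg, rfl, (Arr.inv_mul_self g).symm⟩

/-- `γ'⋆ γ'` consists of the units over `supp γ'`, so the product restricts `γ` to these sources.
Writing an inclusion of bisections as a product lets `α_mul` compare their actions. -/
theorem mul_star_mul_self {γ γ' : OpenBisection X} (h : γ'.carrier ⊆ γ.carrier) :
    γ * (star γ' * γ') = γ' := by
  refine ext_mem fun k => ?_
  constructor
  · rintro ⟨g, hg, u, hu, e, rfl⟩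
    obtain ⟨x, ⟨g', hg', rfl⟩, rfl⟩ := mem_star_mul_self.1 hu
    obtain rfl : g' = g := γ.eq_of_left_eq (h hg') hg e
    rwa [Arr.mul_unit]
  · intro hk
    exact ⟨k, h hk, _, mem_star_mul_self.2 ⟨_, ⟨k, hk, rfl⟩, rfl⟩, rfl, (Arr.mul_unit k).symm⟩

theorem supp_star_mul_self (γ : OpenBisection X) : (star γ * γ).supp = γ.supp := by
  ext x
  constructor
  · rintro ⟨k, hk, rfl⟩
    obtain ⟨x, hx, rfl⟩ := mem_star_mul_self.1 hk
    exact hx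
  · intro hx
    exact ⟨_, mem_star_mul_self.2 ⟨x, hx, rfl⟩, rfl⟩

theorem star_mul_self_mul_star_mul_self (γ : OpenBisection X) :
    (star γ * γ) * (star γ * γ) = star γ * γ := by
  refine ext_mem fun k => ?_
  constructor
  · rintro ⟨g, hg, u, hu, e, rfl⟩
    obtain ⟨x, hx, rfl⟩ := mem_star_mul_self.1 hg
    obtain ⟨y, hy, rfl⟩ := mem_star_mul_self.1 hu
    obtain rfl : y = x := e
    exact mem_star_mul_self.2 ⟨y, hx, Arr.mul_unit (Arr.unit y)⟩
  · intro hk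
    obtain ⟨x, hx, rfl⟩ := mem_star_mul_self.1 hk
    exact ⟨_, hk, _, hk, rfl, (Arr.mul_unit (Arr.unit x)).symm⟩

theorem isOpen_supp (γ : OpenBisection X) : IsOpen γ.supp := by
  rw [← im_star]
  exact isOpen_im _

end OpenBisection

/-! ### Bump functions on the space of units. -/

section Urysohn

variable {X : Type u} [TopologicalSpace X] [CompactSpace X] [T2Space X]

/-- Urysohn's lemma. Self-adjointness of `f` is included so that `b ↦ f b f` preserves positivity.
-/
theorem exists_vanishesOff_eq_one {U : Set X} (hU : IsOpen U) {x : X} (hx : x ∈ U) :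
    ∃ f : C(X, ℂ), VanishesOff U f ∧ f x = 1 ∧ star f = f := by
  obtain ⟨f, h0, h1, -⟩ := exists_continuous_zero_one_of_isClosed hU.isClosed_compl
    (isClosed_singleton (x := x)) (by simpa using hx)
  refine ⟨⟨fun y => (f y : ℂ), by fun_prop⟩, fun y hy => ?_, ?_, ?_⟩
  · simp [h0 hy]
  · simp [h1 rfl]
  · ext y
    simp

end Urysohn

/-! ### The action of open bisections -/

namespace GroupoidCStarAlgebra

variable {X : Type u} [Groupoid.{u} X] [TopologicalSpace X] [CompactSpace X] [T2Space X]
  [TopologicalSpace (Arr X)] [EtaleGroupoid X]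

section Action

variable (A : GroupoidCStarAlgebra X) (γ : OpenBisection X)

open Classical in
/-- The action of `γ`, extended by zero to all of `A`. -/
def act (a : A) : A := if h : a ∈ hereditary A.ι γ.supp then A.α γ ⟨a, h⟩ else 0

variable {A} {γ}

theorem act_of_mem {a : A} (h : a ∈ hereditary A.ι γ.supp) : A.act γ a = A.α γ ⟨a, h⟩ :=
  dif_pos h

theorem act_mem {a : A} (h : a ∈ hereditary A.ι γ.supp) : A.act γ a ∈ hereditary A.ι γ.im := by
  rw [act_of_mem h]
  exact Subtype.prop _

theorem act_add {a b : A} (ha : a ∈ hereditary A.ι γ.supp) (hb : b ∈ hereditary A.ι γ.supp) :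
    A.act γ (a + b) = A.act γ a + A.act γ b := by
  rw [act_of_mem ha, act_of_mem hb, act_of_mem (add_mem ha hb)]
  exact congrArg Subtype.val (map_add (A.α γ) ⟨a, ha⟩ ⟨b, hb⟩)

theorem act_smul (c : ℂ) {a : A} (ha : a ∈ hereditary A.ι γ.supp) :
    A.act γ (c • a) = c • A.act γ a := by
  rw [act_of_mem ha, act_of_mem (SMulMemClass.smul_mem c ha)]
  exact congrArg Subtype.val (map_smul (A.α γ) c ⟨a, ha⟩)

theorem act_mul {a b : A} (ha : a ∈ hereditary A.ι γ.supp) (hb : b ∈ hereditary A.ι γ.supp) :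
    A.act γ (a * b) = A.act γ a * A.act γ b := by
  rw [act_of_mem ha, act_of_mem hb, act_of_mem (mul_mem ha hb)]
  exact congrArg Subtype.val (map_mul (A.α γ) ⟨a, ha⟩ ⟨b, hb⟩)

theorem act_apply_star {a : A} (ha : a ∈ hereditary A.ι γ.supp) :
    A.act γ (star a) = star (A.act γ a) := by
  rw [act_of_mem ha, act_of_mem (star_mem ha)]
  exact congrArg Subtype.val (map_star (A.α γ) ⟨a, ha⟩)

theorem act_ι {f : C(X, ℂ)} (hf : VanishesOff γ.supp f) :
    A.act γ (A.ι f) = A.ι (transport γ f hf) := by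
  rw [act_of_mem (mem_hereditary A.ι hf), A.α_ι]

theorem act_act_mem {γ₁ γ₂ : OpenBisection X} {a : A}
    (ha : a ∈ hereditary A.ι (γ₁ * γ₂).supp) :
    A.act γ₂ a ∈ hereditary A.ι γ₁.supp ∧ A.act γ₁ (A.act γ₂ a) = A.act (γ₁ * γ₂) a := by
  obtain ⟨h, e⟩ := A.α_mul γ₁ γ₂ a ha
  have h₂ := hereditary_mono A.ι (OpenBisection.supp_mul_subset γ₁ γ₂) ha
  have h₁ := hereditary_mono A.ι Set.inter_subset_left h
  rw [act_of_mem h₂, act_of_mem h₁, act_of_mem ha]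
  exact ⟨h₁, e⟩

theorem act_act {γ₁ γ₂ : OpenBisection X} {a : A} (ha : a ∈ hereditary A.ι (γ₁ * γ₂).supp) :
    A.act γ₁ (A.act γ₂ a) = A.act (γ₁ * γ₂) a := (act_act_mem ha).2

/-- That units act trivially is not an axiom. The bisection `γ⋆ γ` is idempotent, so its action is
an idempotent map; being injective as well, it is the identity. -/
theorem act_star_mul_self {a : A} (ha : a ∈ hereditary A.ι γ.supp) :
    A.act (star γ * γ) a = a := by
  have h : a ∈ hereditary A.ι (star γ * γ).supp := by rwa [γ.supp_star_mul_self]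
  have h' : a ∈ hereditary A.ι ((star γ * γ) * (star γ * γ)).supp := by
    rwa [γ.star_mul_self_mul_star_mul_self]
  obtain ⟨h₁, e⟩ := act_act_mem h'
  rw [γ.star_mul_self_mul_star_mul_self, act_of_mem h₁] at e
  exact congrArg Subtype.val
    ((A.α (star γ * γ)).injective (Subtype.ext (e.trans (act_of_mem h))))

theorem act_star_act {a : A} (ha : a ∈ hereditary A.ι γ.supp) :
    A.act (star γ) (A.act γ a) = a := by
  rw [act_act (by rwa [γ.supp_star_mul_self]), act_star_mul_self ha]

theorem act_act_star {a : A} (ha : a ∈ hereditary A.ι γ.im) :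
    A.act γ (A.act (star γ) a) = a := by
  have := act_star_act (γ := star γ) (a := a) (by rwa [γ.supp_star])
  rwa [star_star'] at this

theorem act_star_mem {a : A} (ha : a ∈ hereditary A.ι γ.im) :
    A.act (star γ) a ∈ hereditary A.ι γ.supp := by
  rw [← γ.im_star]
  exact act_mem (by rwa [γ.supp_star])

/-- Locality of the action: `γ' = γ (γ'⋆ γ')`, and the second factor acts trivially. -/
theorem act_of_subset {γ' : OpenBisection X} (h : γ'.carrier ⊆ γ.carrier) {a : A}
    (ha : a ∈ hereditary A.ι γ'.supp) : A.act γ' a = A.act γ a := by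
  have := act_act (γ₁ := γ) (γ₂ := star γ' * γ') (a := a)
    (by rwa [OpenBisection.mul_star_mul_self h])
  rw [OpenBisection.mul_star_mul_self h, act_star_mul_self ha] at this
  exact this.symm

/-- A positive element of `A_U` is of the form `d⋆ d` with `d ∈ A_U`. -/
theorem exists_mem_hereditary_eq_star_mul_self {U : Set X} {a : A}
    (ha : a ∈ hereditary A.ι U) (h0 : 0 ≤ a) :
    ∃ d ∈ hereditary A.ι U, a = star d * d := by
  have hc : IsClosed (hereditary A.ι U : Set A) := isClosed_closure
  refine ⟨CFC.sqrt a, ?_, ?_⟩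
  · rw [CFC.sqrt_eq_real_sqrt a]
    exact cfcₙ_mem _ ha
  · rw [(CFC.sqrt_nonneg a).isSelfAdjoint.star_eq, CFC.sqrt_mul_sqrt_self a]

theorem transport_apply_right {f : C(X, ℂ)} (hf : VanishesOff γ.supp f) {g : Arr X} (hg : g ∈ γ) :
    transport γ f hf g.right = f g.left := by
  have hi : g.right ∈ γ.im := ⟨g, hg, rfl⟩
  rw [transport_apply, transportFun, dif_pos hi, OpenBisection.psiStar, γ.lift_eq hg _ rfl]

end Action

end GroupoidCStarAlgebra

/-! ### Equivariant maps into `ℓ^∞(G)` -/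

namespace GroupoidCStarAlgebra

variable {X : Type u} [Groupoid.{u} X] [TopologicalSpace X] [CompactSpace X] [T2Space X]
  [TopologicalSpace (Arr X)] [EtaleGroupoid X]

section Hom

variable {A B : GroupoidCStarAlgebra X}

open scoped CStarAlgebra

/-- The completely positive map underlying a `G`-ucp map. -/
def Hom.cp (φ : A ⟶ B) : A →CP B := Hom.toCompletelyPositiveMap φ

theorem Hom.map_one (φ : A ⟶ B) : φ 1 = 1 := Hom.map_one' φ

theorem Hom.map_ι (φ : A ⟶ B) (f : C(X, ℂ)) : φ (A.ι f) = B.ι f := Hom.map_ι' φ f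

theorem Hom.map_add (φ : A ⟶ B) (a b : A) : φ (a + b) = φ a + φ b :=
  _root_.map_add (Hom.cp φ) a b

theorem Hom.map_smul (φ : A ⟶ B) (c : ℂ) (a : A) : φ (c • a) = c • φ a :=
  _root_.map_smul (Hom.cp φ) c a

theorem Hom.map_star (φ : A ⟶ B) (a : A) : φ (star a) = star (φ a) :=
  (Hom.cp φ).apply_star a

theorem Hom.map_nonneg (φ : A ⟶ B) {a : A} (ha : 0 ≤ a) : 0 ≤ φ a :=
  _root_.map_nonneg (Hom.cp φ) ha

theorem Hom.map_cstarMatrix_nonneg (φ : A ⟶ B) {k : ℕ} {M : CStarMatrix (Fin k) (Fin k) A}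
    (hM : 0 ≤ M) : 0 ≤ M.map φ :=
  CompletelyPositiveMap.map_cstarMatrix_nonneg' (Hom.cp φ) k M hM

theorem Hom.mem_hereditary (φ : A ⟶ B) {γ : OpenBisection X} {a : A}
    (ha : a ∈ hereditary A.ι γ.supp) : φ a ∈ hereditary B.ι γ.supp :=
  (Hom.equivariant' φ γ ⟨a, ha⟩).1

theorem Hom.map_act (φ : A ⟶ B) {γ : OpenBisection X} {a : A}
    (ha : a ∈ hereditary A.ι γ.supp) : φ (A.act γ a) = B.act γ (φ a) := by
  obtain ⟨h, e⟩ := Hom.equivariant' φ γ ⟨a, ha⟩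
  rw [act_of_mem ha]
  exact e.trans (act_of_mem h).symm

@[ext] theorem Hom.ext' {φ ψ : A ⟶ B} (h : ∀ a, φ a = ψ a) : φ = ψ :=
  DFunLike.ext φ ψ h

/-- The case of `1 × 1` matrices, with positivity carried between an algebra and its `1 × 1`
matrices by factorisations `b⋆ b`. -/
theorem IsCompleteOrderEmbedding.nonneg_iff {φ : A ⟶ B} (h : IsCompleteOrderEmbedding φ) (a : A) :
    0 ≤ φ a ↔ 0 ≤ a := by
  refine ⟨fun ha => ?_, φ.map_nonneg⟩
  obtain ⟨b, hb⟩ := exists_eq_star_mul_self ha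
  let M : CStarMatrix (Fin 1) (Fin 1) A := CStarMatrix.ofMatrix fun _ _ => a
  let N : CStarMatrix (Fin 1) (Fin 1) B := CStarMatrix.ofMatrix fun _ _ => b
  have hM : M.map φ = star N * N := by
    ext i j
    simp [M, N, CStarMatrix.map_apply, CStarMatrix.mul_apply, CStarMatrix.star_apply]
    exact hb
  have hM0 : 0 ≤ M.map φ := hM ▸ star_mul_self_nonneg N
  have := CStarMatrix.sum_star_mul_mul_nonneg ((h 1 M).1 hM0) 1
  simp only [Finset.univ_unique, Finset.sum_singleton, Pi.one_apply, star_one, one_mul,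
    mul_one] at this
  exact this

/-- A `G`-ucp map into a commutative algebra, from a positive equivariant linear map. -/
def Hom.ofCommute (hB : ∀ a b : B, a * b = b * a) (φ : A →ₗ[ℂ] B)
    (h0 : ∀ a, 0 ≤ φ (star a * a)) (hι : ∀ f, φ (A.ι f) = B.ι f)
    (hm : ∀ (γ : OpenBisection X) (a : A), a ∈ hereditary A.ι γ.supp →
      φ a ∈ hereditary B.ι γ.supp)
    (he : ∀ (γ : OpenBisection X) (a : A), a ∈ hereditary A.ι γ.supp →
      φ (A.act γ a) = B.act γ (φ a)) : A ⟶ B :=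
  show Hom A B from
  { toLinearMap := φ
    map_cstarMatrix_nonneg' := fun k M hM =>
      -- Objects carry only a `CStarAlgebra` structure, so commutativity enters as a hypothesis and
      -- the commutative structure is assembled locally.
      let _ : CommCStarAlgebra B := { B.cstar with mul_comm := hB }
      map_cstarMatrix_nonneg_of_commute φ h0 hM
    map_one' := by
      have := hι 1
      rwa [_root_.map_one A.ι, _root_.map_one B.ι] at this
    map_ι' := hι
    equivariant' := fun γ a => by
      refine ⟨hm γ a a.2, ?_⟩
      have := he γ a a.2
      rw [act_of_mem a.2, act_of_mem (hm γ a a.2)] at this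
      exact this }

end Hom

/-- Evaluation at `x` as a character of `C(X)`. -/
def evalCharacter (x : X) : C(X, ℂ) →⋆ₐ[ℂ] ℂ := ContinuousMap.evalStarAlgHom ℂ ℂ x

variable {B : GroupoidCStarAlgebra X}

/-- The conditions on `Ψ : B → (G → ℂ)` that characterise the `G`-ucp maps `B → ℓ^∞(G)`, stated
pointwise. -/
structure IsEquivariantUCP (Ψ : B → Arr X → ℂ) : Prop where
  map_add (a b : B) (g : Arr X) : Ψ (a + b) g = Ψ a g + Ψ b g
  map_smul (c : ℂ) (a : B) (g : Arr X) : Ψ (c • a) g = c * Ψ a g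
  nonneg (a : B) (g : Arr X) : 0 ≤ Ψ (star a * a) g
  map_ι (f : C(X, ℂ)) (g : Arr X) : Ψ (B.ι f) g = f g.right
  equivariant (γ : OpenBisection X) (a : B) (ha : a ∈ hereditary B.ι γ.supp) (g : Arr X) :
    Ψ (B.act γ a) g = translateFun γ (Ψ a) g

namespace IsEquivariantUCP

variable {Ψ : B → Arr X → ℂ}

/-- The state `a ↦ Ψ a g`. -/
def functional (h : IsEquivariantUCP Ψ) (g : Arr X) : B →ₗ[ℂ] ℂ where
  toFun a := Ψ a g
  map_add' a b := h.map_add a b g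
  map_smul' c a := h.map_smul c a g

theorem isPositiveFunctional (h : IsEquivariantUCP Ψ) (g : Arr X) :
    IsPositiveFunctional (h.functional g) := fun a => h.nonneg a g

theorem map_one (h : IsEquivariantUCP Ψ) (g : Arr X) : Ψ 1 g = 1 := by
  rw [← _root_.map_one B.ι, h.map_ι]
  rfl

theorem norm_le (h : IsEquivariantUCP Ψ) (a : B) (g : Arr X) : ‖Ψ a g‖ ≤ ‖a‖ :=
  (h.isPositiveFunctional g).norm_le (h.map_one g) a

/-- The state at `g` restricts on `C(X)` to the character evaluation at `r(g)`, so it is modular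
over `C(X)`. -/
theorem map_ι_mul (h : IsEquivariantUCP Ψ) (f : C(X, ℂ)) (a : B) (g : Arr X) :
    Ψ (B.ι f * a) g = f g.right * Ψ a g :=
  (h.isPositiveFunctional g).apply_mul_of_character (χ := evalCharacter g.right)
    (fun d => h.map_ι d g) f a

theorem map_mul_ι (h : IsEquivariantUCP Ψ) (a : B) (f : C(X, ℂ)) (g : Arr X) :
    Ψ (a * B.ι f) g = Ψ a g * f g.right :=
  (h.isPositiveFunctional g).apply_mul_of_character' (χ := evalCharacter g.right)
    (fun d => h.map_ι d g) a f

/-- The bounded function `Ψ a`. -/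
def toBounded (h : IsEquivariantUCP Ψ) : B →ₗ[ℂ] BoundedFunctions X where
  toFun a := ⟨Ψ a, memℓp_infty ⟨‖a‖, by
    rintro _ ⟨g, rfl⟩
    exact h.norm_le a g⟩⟩
  map_add' a b := by
    ext g
    exact h.map_add a b g
  map_smul' c a := by
    ext g
    exact h.map_smul c a g

theorem toBounded_apply (h : IsEquivariantUCP Ψ) (a : B) (g : Arr X) : h.toBounded a g = Ψ a g :=
  rfl

/-- Modularity over `C(X)` takes generators `f a f'` to generators, and contractivity passes to the
closure. So preservation of `A_U` need not be imposed in `IsEquivariantUCP`. -/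
theorem toBounded_mem (h : IsEquivariantUCP Ψ) {U : Set X} {a : B} (ha : a ∈ hereditary B.ι U) :
    h.toBounded a ∈ hereditary rangePullback U := by
  refine hereditary_induction B.ι U
    ((hereditary rangePullback U).toSubmodule.comap h.toBounded) ?_ ?_ ha
  · refine IsClosed.preimage (f := h.toBounded) ?_ isClosed_closure
    refine AddMonoidHomClass.continuous_of_bound h.toBounded 1 fun a => ?_
    rw [one_mul]
    exact BoundedFunctions.norm_le (norm_nonneg a) fun g => h.norm_le a g
  · intro f a f' hf hf'
    change h.toBounded _ ∈ hereditary rangePullback U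
    have : h.toBounded (B.ι f * a * B.ι f') =
        rangePullback f * h.toBounded a * rangePullback f' := by
      ext g
      simp only [BoundedFunctions.mul_apply, toBounded_apply, rangePullback_apply, h.map_mul_ι,
        h.map_ι_mul]
    rw [this]
    exact gen_mem_hereditary _ hf hf' _

end IsEquivariantUCP

theorem BoundedFunctions.eq_star_mul_self {b : BoundedFunctions X} (hb : ∀ g, 0 ≤ b g) :
    ∃ c : BoundedFunctions X, b = star c * c := by
  refine ⟨⟨fun g => (√(b g).re : ℂ), memℓp_infty ⟨√‖b‖, ?_⟩⟩, ?_⟩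
  · rintro _ ⟨g, rfl⟩
    simp only [Complex.norm_real, Real.norm_of_nonneg (Real.sqrt_nonneg _)]
    exact Real.sqrt_le_sqrt ((Complex.re_le_norm _).trans (b.norm_apply_le g))
  · ext g
    have := Complex.le_def.1 (hb g)
    change b g = star (√(b g).re : ℂ) * (√(b g).re : ℂ)
    rw [Complex.star_def, Complex.conj_ofReal, ← Complex.ofReal_mul, Real.mul_self_sqrt this.1]
    exact Complex.ext rfl this.2.symm

theorem ellInfty_mul_comm (a b : ellInfty X) : a * b = b * a :=
  mul_comm (G := BoundedFunctions X) a b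

theorem ellInfty_act {γ : OpenBisection X} {a : BoundedFunctions X}
    (ha : a ∈ hereditary (rangePullback (X := X)) γ.supp) :
    (ellInfty X).act γ a = translate γ a :=
  act_of_mem (A := ellInfty X) ha

namespace IsEquivariantUCP

variable {Ψ : B → Arr X → ℂ}

/-- The `G`-ucp map given by `Ψ`. -/
def toHom (h : IsEquivariantUCP Ψ) : B ⟶ ellInfty X :=
  Hom.ofCommute ellInfty_mul_comm h.toBounded
    (fun a => by
      obtain ⟨c, hc⟩ := BoundedFunctions.eq_star_mul_self (b := h.toBounded (star a * a))
        fun g => h.nonneg a g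
      exact (star_mul_self_nonneg (R := ellInfty X) c).trans_eq hc.symm)
    (fun f => BoundedFunctions.ext fun g => h.map_ι f g)
    (fun γ a ha => h.toBounded_mem ha)
    (fun γ a ha => by
      refine (BoundedFunctions.ext fun g => ?_).trans (ellInfty_act (h.toBounded_mem ha)).symm
      exact h.equivariant γ a ha g)

/-- The function `G → ℂ` underlying an element of `ℓ^∞(G)`. -/
def _root_.GroupoidCStarAlgebra.evalArr (a : ellInfty X) : Arr X → ℂ :=
  DFunLike.coe (F := BoundedFunctions X) a

theorem _root_.GroupoidCStarAlgebra.evalArr_injective :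
    Function.Injective (evalArr : ellInfty X → Arr X → ℂ) :=
  fun _ _ h => BoundedFunctions.ext fun g => congrFun h g

theorem of_hom (φ : B ⟶ ellInfty X) : IsEquivariantUCP fun a => evalArr (φ a) where
  map_add a b g := by rw [φ.map_add]; rfl
  map_smul c a g := by rw [φ.map_smul]; rfl
  nonneg a g := by
    obtain ⟨c, hc⟩ := exists_eq_star_mul_self (φ.map_nonneg (star_mul_self_nonneg a))
    rw [hc]
    exact star_mul_self_nonneg (evalArr c g)
  map_ι f g := by rw [φ.map_ι]; rfl
  equivariant γ a ha g := by
    rw [φ.map_act ha]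
    exact congrArg (fun b : BoundedFunctions X => b g) (ellInfty_act (φ.mem_hereditary ha))

end IsEquivariantUCP

end GroupoidCStarAlgebra

/-! ### Injectivity of `ℓ^∞(G)` -/

namespace GroupoidCStarAlgebra

variable {X : Type u} [Groupoid.{u} X] [TopologicalSpace X] [CompactSpace X] [T2Space X]
  [TopologicalSpace (Arr X)] [EtaleGroupoid X] {B : GroupoidCStarAlgebra X}

/-- A positive functional on `B` that restricts to evaluation at `x` on `C(X)`. -/
structure IsStateOver (x : X) (τ : B →ₗ[ℂ] ℂ) : Prop where
  pos : IsPositiveFunctional τ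
  map_ι (f : C(X, ℂ)) : τ (B.ι f) = f x

namespace IsStateOver

variable {x : X} {τ : B →ₗ[ℂ] ℂ}

theorem norm_le (h : IsStateOver x τ) (a : B) : ‖τ a‖ ≤ ‖a‖ :=
  h.pos.norm_le (by simpa using h.map_ι 1) a

theorem map_conj (h : IsStateOver x τ) (f f' : C(X, ℂ)) (a : B) :
    τ (B.ι f * a * B.ι f') = f x * τ a * f' x := by
  rw [h.pos.apply_mul_of_character' (χ := evalCharacter x) h.map_ι,
    h.pos.apply_mul_of_character (χ := evalCharacter x) h.map_ι]
  rfl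

/-- Localisation: cutting `a` by a bump function at `x` moves it into a hereditary subalgebra, where
bisections act, without changing its value under a state over `x`. -/
theorem map_conj_eq (h : IsStateOver x τ) {f : C(X, ℂ)} (hf : f x = 1) (a : B) :
    τ (B.ι f * a * B.ι f) = τ a := by
  rw [h.map_conj, hf, one_mul, mul_one]

theorem eq_zero_of_mem (h : IsStateOver x τ) {U : Set X} (hx : x ∉ U) {a : B}
    (ha : a ∈ hereditary B.ι U) : τ a = 0 := by
  refine hereditary_induction B.ι U (LinearMap.ker τ) ?_ (fun f a f' hf _ => ?_) ha
  · have : Continuous τ := AddMonoidHomClass.continuous_of_bound τ 1 fun a => by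
      rw [one_mul]
      exact h.norm_le a
    exact isClosed_eq this continuous_const
  · rw [LinearMap.mem_ker, h.map_conj, hf x hx, zero_mul, zero_mul]

end IsStateOver

theorem act_conj {γ : OpenBisection X} {f : C(X, ℂ)} (hf : VanishesOff γ.supp f) {a : B}
    (ha : a ∈ hereditary B.ι γ.supp) :
    B.act γ (B.ι f * a * B.ι f) =
      B.ι (transport γ f hf) * B.act γ a * B.ι (transport γ f hf) := by
  have hf' := mem_hereditary B.ι hf
  rw [act_mul (mul_mem hf' ha) hf', act_mul hf' ha, act_ι hf]

theorem conj_mem {U : Set X} {f : C(X, ℂ)} (hf : VanishesOff U f) (a : B) :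
    B.ι f * a * B.ι f ∈ hereditary B.ι U := gen_mem_hereditary B.ι hf hf a

/-- The translate of a state over `s(g)` to a state over `r(g)`. -/
theorem exists_isStateOver_translate (g : Arr X) {μ : B →ₗ[ℂ] ℂ} (hμ : IsStateOver g.left μ) :
    ∃ τ : B →ₗ[ℂ] ℂ, IsStateOver g.right τ ∧ ∀ γ : OpenBisection X, g ∈ γ →
      ∀ c ∈ hereditary B.ι γ.supp, τ (B.act γ c) = μ c := by
  -- Fix one bisection through `g` and a bump function at `r(g)`, and put `τ b = μ (α_{γ⋆} (f b
  -- f))`. The second claim shows in particular that the choices do not matter.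
  obtain ⟨γ, hg⟩ := OpenBisection.exists_mem g
  obtain ⟨f, hf, hf1, hfs⟩ := exists_vanishesOff_eq_one γ.isOpen_im ⟨g, hg, rfl⟩
  have hfs' : VanishesOff (star γ).supp f := vanishesOff_star hf
  have hmem (b : B) : B.ι f * b * B.ι f ∈ hereditary B.ι (star γ).supp := conj_mem hfs' b
  have hg' : g.inv ∈ star γ := by simpa [OpenBisection.mem_star] using hg
  let τ : B →ₗ[ℂ] ℂ :=
    { toFun := fun b => μ (B.act (star γ) (B.ι f * b * B.ι f))
      map_add' := fun a b => by rw [mul_add, add_mul, act_add (hmem a) (hmem b), map_add]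
      map_smul' := fun c a => by
        rw [mul_smul_comm, smul_mul_assoc, act_smul c (hmem a), map_smul, RingHom.id_apply] }
  have hτ (b : B) : τ b = μ (B.act (star γ) (B.ι f * b * B.ι f)) := rfl
  have hstate : IsStateOver g.right τ := by
    refine ⟨fun a => ?_, fun h => ?_⟩
    · have h0 : 0 ≤ B.ι f * (star a * a) * B.ι f := by
        have : B.ι f * (star a * a) * B.ι f = star (a * B.ι f) * (a * B.ι f) := by
          rw [star_mul, ← map_star, hfs]
          simp only [mul_assoc]
        rw [this]
        exact star_mul_self_nonneg _
      -- The square root must be taken inside the hereditary subalgebra, where the action of `γ⋆` is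
      -- a ⋆-homomorphism.
      obtain ⟨d, hd, e⟩ := exists_mem_hereditary_eq_star_mul_self (hmem _) h0
      rw [hτ, e, act_mul (star_mem hd) hd, act_apply_star hd]
      exact hμ.pos _
    · have hv : VanishesOff (star γ).supp (f * h * f) := fun x hx => by simp [hfs' x hx]
      rw [hτ, ← map_mul, ← map_mul, act_ι hv, hμ.map_ι]
      have := transport_apply_right hv hg'
      rw [Arr.inv_right, Arr.inv_left] at this
      rw [this]
      simp [hf1]
  refine ⟨τ, hstate, fun γ' hg₂ c hc => ?_⟩
  -- Near `g` any two bisections agree: cut `c` down to the support of `γ' ∩ γ`, where their actions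
  -- coincide by locality.
  obtain ⟨h, hh, hh1, -⟩ := exists_vanishesOff_eq_one (γ'.inter γ).isOpen_supp
    (x := g.left) ⟨g, ⟨hg₂, hg⟩, rfl⟩
  have hs : (γ'.inter γ).carrier ⊆ γ'.carrier := Set.inter_subset_left
  have hs' : (γ'.inter γ).carrier ⊆ γ.carrier := Set.inter_subset_right
  have hhγ : VanishesOff γ'.supp h := fun x hx =>
    hh x fun hx' => hx (OpenBisection.supp_mono hs hx')
  have hc' := conj_mem hh c
  have hc'' := hereditary_mono B.ι (OpenBisection.supp_mono hs') hc'
  have h1 : τ (B.act γ' c) = τ (B.act γ' (B.ι h * c * B.ι h)) := by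
    rw [act_conj hhγ hc, hstate.map_conj_eq]
    rw [transport_apply_right hhγ hg₂, hh1]
  rw [h1, ← act_of_subset hs hc', act_of_subset hs' hc', hτ,
    act_conj hfs' (by rw [γ.supp_star]; exact act_mem hc''), act_star_act hc'', hμ.map_conj_eq,
    hμ.map_conj_eq hh1]
  have := transport_apply_right hfs' hg'
  rw [Arr.inv_right, Arr.inv_left] at this
  rw [this, hf1]

/-- Going back along `γ'` from a point of `supp γ` lands on a source of a composable pair. This puts
cut-down elements in the domain of the product rule. -/
theorem vanishesOff_supp_mul {γ γ' : OpenBisection X} {f : C(X, ℂ)}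
    (hf : VanishesOff (γ.supp ∩ γ'.im) f) (hf' : VanishesOff (star γ').supp f) :
    VanishesOff (γ * γ').supp (transport (star γ') f hf') := by
  intro x hx
  by_cases h : x ∈ (star γ').im
  · obtain ⟨k, hk, rfl⟩ := h
    rw [transport_apply_right hf' hk]
    refine hf _ fun ⟨⟨g, hg, e⟩, _⟩ => hx ?_
    exact ⟨_, OpenBisection.mem_mul.2 ⟨g, hg, k.inv, hk, e.symm, rfl⟩, rfl⟩
  · exact vanishesOff_transport _ _ hf' x h

/-- A family of states over the points of `X` induces an equivariant map into `ℓ^∞(G)`. -/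
theorem exists_isEquivariantUCP {μ : X → B →ₗ[ℂ] ℂ} (hμ : ∀ x, IsStateOver x (μ x)) :
    ∃ Ψ : B → Arr X → ℂ, IsEquivariantUCP Ψ ∧ ∀ b x, Ψ b (Arr.unit x) = μ x b := by
  choose τ hτ hact using fun g : Arr X => exists_isStateOver_translate g (hμ g.left)
  refine ⟨fun b g => τ g b, ⟨fun a b g => map_add _ _ _, fun c a g => map_smul _ _ _,
    fun a g => (hτ g).pos a, fun f g => (hτ g).map_ι f, fun γ b hb g => ?_⟩, fun b x => ?_⟩
  · by_cases hi : g.right ∈ γ.im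
    · rw [translateFun, dif_pos hi]
      -- Factor `g = u k` with `u ∈ γ`. Equivariance at `g` then reads `τ g (α_γ b) = τ k b`, and
      -- both sides will be expressed by the state at `s(g) = s(k)`.
      set u := γ.lift ⟨g.right, hi⟩ with hu
      have hur : g.right = u.inv.left := by simp [hu]
      have huγ : u ∈ γ := γ.lift_mem _
      set k := Arr.mul u.inv g hur with hk
      have hgk : g = Arr.mul u k rfl := (Arr.mul_inv_mul u g hur).symm
      obtain ⟨γ', hkγ⟩ := OpenBisection.exists_mem k
      obtain ⟨f, hf, hf1, -⟩ := exists_vanishesOff_eq_one (γ.isOpen_supp.inter γ'.isOpen_im)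
        (x := k.right) ⟨⟨u, huγ, rfl⟩, ⟨k, hkγ, rfl⟩⟩
      have hfγ : VanishesOff γ.supp f := fun x hx => hf x fun hx' => hx hx'.1
      have hfγ' : VanishesOff (star γ').supp f :=
        vanishesOff_star fun x hx => hf x fun hx' => hx hx'.2
      set b' := B.ι f * b * B.ι f with hb'
      have hb'γ : b' ∈ hereditary B.ι γ.supp := conj_mem hfγ b
      have hb'γ' : b' ∈ hereditary B.ι (star γ').supp := conj_mem hfγ' b
      -- The element `b` is cut twice: the first cut makes `γ'⋆` act on `b'`, and the second is
      -- carried along by the action, so that `c` lies in the hereditary subalgebra over `supp (γ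
      -- γ')`.
      set c := B.act (star γ') (B.ι f * b' * B.ι f) with hc
      have hcm : c ∈ hereditary B.ι (γ * γ').supp := by
        rw [hc, act_conj hfγ' hb'γ']
        exact conj_mem (vanishesOff_supp_mul hf hfγ') _
      have hcm' := hereditary_mono B.ι (OpenBisection.supp_mul_subset γ γ') hcm
      have e1 : B.act γ' c = B.ι f * b' * B.ι f := by
        rw [hc, act_act_star]
        rw [← γ'.supp_star]
        exact conj_mem hfγ' b'
      have e2 : τ k b = μ g.left c := by
        rw [← (hτ k).map_conj_eq hf1 b, ← hb', ← (hτ k).map_conj_eq hf1 b', ← e1,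
          hact k γ' hkγ c hcm']
        rfl
      have hgm : g ∈ γ * γ' := OpenBisection.mem_mul.2 ⟨u, huγ, k, hkγ, rfl, hgk⟩
      have hF : transport γ f hfγ g.right = 1 := by
        have : g.right = u.right := hur
        rw [this, transport_apply_right hfγ huγ]
        exact hf1
      rw [e2, ← hact g _ hgm c hcm, ← act_act hcm, e1, act_conj hfγ hb'γ, hb', act_conj hfγ hb,
        (hτ g).map_conj_eq hF, (hτ g).map_conj_eq hF]
    · rw [translateFun, dif_neg hi]
      exact (hτ g).eq_zero_of_mem hi (act_mem hb)
  · obtain ⟨γ, hγ⟩ := OpenBisection.exists_mem (Arr.unit x)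
    have hx : x ∈ γ.supp := ⟨_, hγ, rfl⟩
    obtain ⟨f, hf, hf1, -⟩ := exists_vanishesOff_eq_one γ.isOpen_supp hx
    have hm := conj_mem hf b
    change τ (Arr.unit x) b = μ x b
    -- The bisection `γ⋆ γ` contains the unit at `x` and acts trivially, so the translated state
    -- there is `μ x` itself.
    rw [← (hτ (Arr.unit x)).map_conj_eq hf1 b, ← act_star_mul_self hm,
      hact _ _ (OpenBisection.mem_star_mul_self.2 ⟨x, hx, rfl⟩) _
        (by rwa [γ.supp_star_mul_self])]
    exact (hμ x).map_conj_eq hf1 b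

namespace IsEquivariantUCP

variable {Ψ Ψ' : B → Arr X → ℂ}

theorem isStateOver (h : IsEquivariantUCP Ψ) (g : Arr X) :
    IsStateOver g.right (h.functional g) :=
  ⟨h.isPositiveFunctional g, fun f => h.map_ι f g⟩

theorem apply_act (h : IsEquivariantUCP Ψ) {γ : OpenBisection X} {g : Arr X} (hg : g ∈ γ) {a : B}
    (ha : a ∈ hereditary B.ι γ.supp) : Ψ (B.act γ a) g = Ψ a (Arr.unit g.left) := by
  have hi : g.right ∈ γ.im := ⟨g, hg, rfl⟩
  have hl : γ.lift ⟨g.right, hi⟩ = g := γ.lift_eq hg _ rfl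
  rw [h.equivariant γ a ha, translateFun, dif_pos hi]
  simp only [hl, Arr.inv_mul_self]

/-- An equivariant map into `ℓ^∞(G)` is determined by its values at the units. -/
theorem eq_of_unit (h : IsEquivariantUCP Ψ) (h' : IsEquivariantUCP Ψ')
    (e : ∀ a x, Ψ a (Arr.unit x) = Ψ' a (Arr.unit x)) : Ψ = Ψ' := by
  funext a g
  obtain ⟨γ, hg⟩ := OpenBisection.exists_mem g
  obtain ⟨f, hf, hf1, -⟩ := exists_vanishesOff_eq_one γ.isOpen_im ⟨g, hg, rfl⟩
  have hm := conj_mem hf a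
  -- After localisation at `r(g)`, translating back along `γ` turns a value at `g` into a value at
  -- the unit of `s(g)`.
  have key {Ψ : B → Arr X → ℂ} (h : IsEquivariantUCP Ψ) :
      Ψ a g = Ψ (B.act (star γ) (B.ι f * a * B.ι f)) (Arr.unit g.left) := by
    rw [← h.apply_act hg (act_star_mem hm), act_act_star hm]
    exact ((h.isStateOver g).map_conj_eq hf1 a).symm
  rw [key h, key h', e]

end IsEquivariantUCP

/-- The state of `φ` at each unit is extended along `j` independently of the others. The extension
still lies over its unit because `j` respects `C(X)`, and the resulting map restricts to `φ` because
both are determined at the units. -/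
theorem isInjective_ellInfty : (ellInfty X).IsInjective := by
  intro A B j hj φ
  have hφ := IsEquivariantUCP.of_hom φ
  choose μ hμ hμj using fun x : X =>
    exists_isPositiveFunctional_extension (Hom.cp j).toLinearMap (Hom.map_one j) (Hom.map_star j)
      hj.nonneg_iff (hφ.isPositiveFunctional (Arr.unit x))
  have hstate (x : X) : IsStateOver x (μ x) := by
    refine ⟨hμ x, fun f => ?_⟩
    rw [← Hom.map_ι j]
    exact (hμj x (A.ι f)).trans (hφ.map_ι f (Arr.unit x))
  obtain ⟨Ψ, hΨ, hunit⟩ := exists_isEquivariantUCP hstate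
  refine ⟨hΨ.toHom, Hom.ext' fun a => evalArr_injective ?_⟩
  refine congrFun ((IsEquivariantUCP.of_hom (j ≫ hΨ.toHom)).eq_of_unit hφ fun a x => ?_) a
  exact (hunit (j a) x).trans (hμj x a)

end GroupoidCStarAlgebra

/-! ### A minimal idempotent -/

namespace GroupoidCStarAlgebra

variable {X : Type u} [Groupoid.{u} X] [TopologicalSpace X] [CompactSpace X] [T2Space X]
  [TopologicalSpace (Arr X)] [EtaleGroupoid X] {B : GroupoidCStarAlgebra X}

/-- Every condition involves only finitely many coordinates of `Ψ`; here the pointwise form of the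
definition pays off. -/
theorem isClosed_isEquivariantUCP :
    IsClosed {Ψ : B → Arr X → ℂ | IsEquivariantUCP Ψ} := by
  have h : {Ψ : B → Arr X → ℂ | IsEquivariantUCP Ψ} =
      {Ψ | ∀ a b g, Ψ (a + b) g = Ψ a g + Ψ b g} ∩ {Ψ | ∀ (c : ℂ) a g, Ψ (c • a) g = c * Ψ a g} ∩
      {Ψ | ∀ a g, 0 ≤ Ψ (star a * a) g} ∩ {Ψ | ∀ (f : C(X, ℂ)) g, Ψ (B.ι f) g = f g.right} ∩
      {Ψ | ∀ (γ : OpenBisection X) (a : B), a ∈ hereditary B.ι γ.supp → ∀ g,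
        Ψ (B.act γ a) g = translateFun γ (Ψ a) g} := by
    ext Ψ
    exact ⟨fun h => ⟨⟨⟨⟨h.1, h.2⟩, h.3⟩, h.4⟩, h.5⟩,
      fun h => ⟨h.1.1.1.1, h.1.1.1.2, h.1.1.2, h.1.2, h.2⟩⟩
  rw [h]
  simp only [Set.ofPred_forall]
  refine (((IsClosed.inter ?_ ?_).inter ?_).inter ?_).inter ?_
  · exact isClosed_iInter fun a => isClosed_iInter fun b => isClosed_iInter fun g =>
      isClosed_eq (by fun_prop) (by fun_prop)
  · exact isClosed_iInter fun a => isClosed_iInter fun b => isClosed_iInter fun g =>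
      isClosed_eq (by fun_prop) (by fun_prop)
  · exact isClosed_iInter fun a => isClosed_iInter fun g =>
      isClosed_le (by fun_prop) (by fun_prop)
  · exact isClosed_iInter fun f => isClosed_iInter fun g =>
      isClosed_eq (by fun_prop) (by fun_prop)
  · refine isClosed_iInter fun γ => isClosed_iInter fun a => isClosed_iInter fun ha =>
      isClosed_iInter fun g => isClosed_eq (by fun_prop) ?_
    simp only [translateFun]
    split_ifs <;> fun_prop

/-- Contractivity places these maps in a product of discs, to which Tychonoff's theorem applies. -/
theorem isCompact_isEquivariantUCP :
    IsCompact {Ψ : B → Arr X → ℂ | IsEquivariantUCP Ψ} := by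
  refine IsCompact.of_isClosed_subset (isCompact_univ_pi fun a : B => isCompact_univ_pi
    fun _ : Arr X => isCompact_closedBall (0 : ℂ) ‖a‖) isClosed_isEquivariantUCP fun Ψ h => ?_
  intro a _ g _
  simpa using h.norm_le a g

/-- The topology of pointwise convergence on the set of `G`-ucp maps `B → ℓ^∞(G)`. -/
instance : TopologicalSpace (B ⟶ ellInfty X) :=
  .induced (fun φ a => evalArr (φ a)) inferInstance

theorem isInducing_evalArr :
    IsInducing (fun (φ : B ⟶ ellInfty X) (a : B) => evalArr (φ a)) := ⟨rfl⟩

theorem continuous_evalArr (a : B) (g : Arr X) :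
    Continuous fun φ : B ⟶ ellInfty X => evalArr (φ a) g :=
  continuous_pi_iff.1 (continuous_pi_iff.1 isInducing_evalArr.continuous a) g

instance : CompactSpace (B ⟶ ellInfty X) := by
  rw [← isCompact_univ_iff, isInducing_evalArr.isCompact_iff]
  convert isCompact_isEquivariantUCP (B := B)
  ext Ψ
  simp only [Set.image_univ, Set.mem_range, Set.mem_ofPred_eq]
  constructor
  · rintro ⟨φ, rfl⟩
    exact .of_hom φ
  · intro h
    exact ⟨h.toHom, rfl⟩

theorem IsEquivariantUCP.average {Ψ : ℕ → B → Arr X → ℂ} (h : ∀ k, IsEquivariantUCP (Ψ k))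
    (n : ℕ) : IsEquivariantUCP fun a g =>
      ((n + 1 : ℝ)⁻¹ : ℂ) * ∑ k ∈ Finset.range (n + 1), Ψ k a g where
  map_add a b g := by simp [(h _).map_add, Finset.sum_add_distrib, mul_add]
  map_smul c a g := by
    simp only [(h _).map_smul, ← Finset.mul_sum]
    ring
  nonneg a g := by
    refine mul_nonneg ?_ (Finset.sum_nonneg fun k _ => (h k).nonneg a g)
    exact_mod_cast (by positivity : (0 : ℝ) ≤ (n + 1 : ℝ)⁻¹)
  map_ι f g := by
    simp only [(h _).map_ι, Finset.sum_const, Finset.card_range, nsmul_eq_mul]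
    have : (n + 1 : ℂ) ≠ 0 := by exact_mod_cast n.succ_ne_zero
    push_cast
    field_simp
  equivariant γ a ha g := by
    simp only [(h _).equivariant γ a ha, translateFun]
    split_ifs <;> simp

/-- The iterates of a `G`-ucp map. -/
def iterate (θ : B ⟶ B) : ℕ → (B ⟶ B)
  | 0 => 𝟙 B
  | k + 1 => θ ≫ iterate θ k

/-- Take `x n` to be the mean of `θ⁰, …, θⁿ`. The difference telescopes to `(θⁿ⁺² a - θ a) / (n +
1)`, of norm at most `2 ‖a‖ / (n + 1)`. -/
theorem exists_comp_average_tendsto (θ : ellInfty X ⟶ ellInfty X) :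
    ∃ x : ℕ → (ellInfty X ⟶ ellInfty X), ∀ a g, Filter.Tendsto
      (fun n => evalArr ((θ ≫ x n) (θ a)) g - evalArr ((θ ≫ x n) a) g) Filter.atTop (𝓝 0) := by
  refine ⟨fun n => (IsEquivariantUCP.average
    (fun k => IsEquivariantUCP.of_hom (iterate θ k)) n).toHom, fun a g => ?_⟩
  have key (n : ℕ) (b : ellInfty X) : evalArr ((θ ≫ (IsEquivariantUCP.average
      (fun k => IsEquivariantUCP.of_hom (iterate θ k)) n).toHom) b) g =
      ((n + 1 : ℝ)⁻¹ : ℂ) * ∑ k ∈ Finset.range (n + 1), evalArr (iterate θ (k + 1) b) g := rfl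
  have e (k : ℕ) : evalArr (iterate θ (k + 1) (θ a)) g = evalArr (iterate θ (k + 2) a) g := rfl
  simp only [key, e, ← mul_sub, ← Finset.sum_sub_distrib]
  simp only [Finset.sum_range_sub fun k => evalArr (iterate θ (k + 1) a) g]
  refine squeeze_zero_norm (a := fun n : ℕ => 2 * ‖a‖ * (1 / ((n : ℝ) + 1))) (fun n => ?_) ?_
  · have h1 (k : ℕ) : ‖evalArr (iterate θ k a) g‖ ≤ ‖a‖ :=
      (IsEquivariantUCP.of_hom (iterate θ k)).norm_le a g
    rw [norm_mul, norm_inv, Complex.norm_real, Real.norm_of_nonneg (by positivity), one_div,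
      mul_comm]
    gcongr
    refine (norm_sub_le _ _).trans ?_
    linarith [h1 (n + 1 + 1), h1 (0 + 1)]
  · simpa using tendsto_one_div_add_atTop_nhds_zero_nat.const_mul (2 * ‖a‖)

/-- There is a `G`-ucp map `e` on `ℓ^∞(G)` with `e s e = e` for all `G`-ucp maps `s`. -/
theorem exists_minimal_idempotent :
    ∃ e : ellInfty X ⟶ ellInfty X, ∀ s : ellInfty X ⟶ ellInfty X, e ≫ s ≫ e = e := by
  -- Closed one-sided ideals: stable under following by any endomorphism. Compactness gives chains
  -- nonempty intersections, hence a minimal member `L`.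
  let S : Set (Set (ellInfty X ⟶ ellInfty X)) :=
    {L | IsClosed L ∧ L.Nonempty ∧ ∀ φ ∈ L, ∀ s : ellInfty X ⟶ ellInfty X, φ ≫ s ∈ L}
  obtain ⟨L, hL⟩ : ∃ L, Minimal (· ∈ S) L := by
    refine zorn_superset S fun c hcS hc => ?_
    rcases c.eq_empty_or_nonempty with rfl | hne
    · exact ⟨Set.univ, ⟨isClosed_univ, ⟨𝟙 _, trivial⟩, fun _ _ _ => trivial⟩, by simp⟩
    · refine ⟨⋂₀ c, ⟨isClosed_sInter fun L hL => (hcS hL).1, ?_, fun φ hφ s L hL =>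
        (hcS hL).2.2 φ (hφ L hL) s⟩, fun L hL => Set.sInter_subset_of_mem hL⟩
      have := hne.to_subtype
      rw [Set.sInter_eq_iInter]
      refine IsCompact.nonempty_iInter_of_directed_nonempty_isCompact_isClosed _ ?_
        (fun L => (hcS L.2).2.1) (fun L => (hcS L.2).1.isCompact) (fun L => (hcS L.2).1)
      exact fun a b => (hc.total a.2 b.2).elim (fun h => ⟨a, subset_rfl, h⟩)
        fun h => ⟨b, h, subset_rfl⟩
  have key (θ) (hθ : θ ∈ L) : ∀ φ ∈ L, θ ≫ φ = φ := by
    -- This is again a member of `S`, so minimality gives `L' = L`. It is closed because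
    -- precomposing with `θ` only changes the point of evaluation, while its nonemptiness needs the
    -- averages.
    let L' := {φ ∈ L | θ ≫ φ = φ}
    have hL' : L' ∈ S := by
      refine ⟨?_, ?_, fun φ hφ s => ⟨hL.prop.2.2 φ hφ.1 s, ?_⟩⟩
      · refine hL.prop.1.inter ?_
        have : {φ : ellInfty X ⟶ ellInfty X | θ ≫ φ = φ} =
            {φ | ∀ a g, evalArr (φ (θ a)) g = evalArr (φ a) g} := by
          ext φ
          refine ⟨fun h a g => ?_, fun h => Hom.ext' fun a => evalArr_injective (funext (h a))⟩
          exact congrArg (fun ψ : ellInfty X ⟶ ellInfty X => evalArr (ψ a) g) h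
        change IsClosed {φ : ellInfty X ⟶ ellInfty X | θ ≫ φ = φ}
        rw [this]
        simp only [Set.ofPred_forall]
        exact isClosed_iInter fun a => isClosed_iInter fun g =>
          isClosed_eq (continuous_evalArr _ g) (continuous_evalArr a g)
      · obtain ⟨x, hx⟩ := exists_comp_average_tendsto θ
        have hxL (n : ℕ) : θ ≫ x n ∈ L := hL.prop.2.2 θ hθ (x n)
        obtain ⟨φ, hφL, hφ⟩ := hL.prop.1.isCompact.exists_mapClusterPt
          (f := Filter.atTop) (u := fun n => θ ≫ x n) (by simp [hxL])
        -- A cluster point of the averages `θ ≫ x n`, all of which lie in `L`, is fixed by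
        -- precomposition with `θ`.
        refine ⟨φ, hφL, Hom.ext' fun a => evalArr_injective (funext fun g => ?_)⟩
        have hF : Continuous fun ψ : ellInfty X ⟶ ellInfty X =>
            evalArr (ψ (θ a)) g - evalArr (ψ a) g :=
          (continuous_evalArr _ g).sub (continuous_evalArr a g)
        have h1 := hφ.continuousAt_comp hF.continuousAt
        have h2 := eq_of_nhds_neBot (h1.neBot.mono (inf_le_inf_left _ (hx a g)))
        exact sub_eq_zero.1 h2
      · exact congrArg (· ≫ s) hφ.2
    exact fun φ hφ => (hL.le_of_le hL' (fun _ h => h.1) hφ).2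
  obtain ⟨e, he⟩ := hL.prop.2.1
  -- Both `e ≫ s` and `e` lie in `L`, so the first, put before the second, leaves it unchanged.
  exact ⟨e, fun s => key (e ≫ s) (hL.prop.2.2 e he s) e he⟩

end GroupoidCStarAlgebra

/-! ### The Choi–Effros algebra of an idempotent -/

/-- `t - a ≤ ‖t - a‖ ≤ t`. A criterion through the norm is wanted because the Choi–Effros algebra
shares its norm with `ℓ^∞(G)`, but not its product. -/
theorem nonneg_of_norm_sub_le {A : Type*} [CStarAlgebra A] [PartialOrder A] [StarOrderedRing A]
    {a : A} (ha : IsSelfAdjoint a) {t : ℝ} (h : ‖algebraMap ℝ A t - a‖ ≤ t) : 0 ≤ a := by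
  have h1 := IsSelfAdjoint.le_algebraMap_norm_self (a := algebraMap ℝ A t - a)
    ((IsSelfAdjoint.algebraMap A (.all t)).sub ha)
  have h2 : algebraMap ℝ A ‖algebraMap ℝ A t - a‖ ≤ algebraMap ℝ A t := algebraMap_mono A h
  simpa using h1.trans h2

namespace GroupoidCStarAlgebra

variable {X : Type u} [Groupoid.{u} X] [TopologicalSpace X] [CompactSpace X] [T2Space X]
  [TopologicalSpace (Arr X)] [EtaleGroupoid X]

section Projection

variable (e : ellInfty X ⟶ ellInfty X)

/-- A `G`-ucp map on `ℓ^∞(G)`, as a linear map on bounded functions. -/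
def projection : BoundedFunctions X →ₗ[ℂ] BoundedFunctions X :=
  (IsEquivariantUCP.of_hom e).toBounded

variable (a b : BoundedFunctions X) (g : Arr X)

theorem projection_one : projection e 1 = 1 := Hom.map_one e

theorem projection_star : projection e (star a) = star (projection e a) := Hom.map_star e a

theorem norm_projection_le : ‖projection e a‖ ≤ ‖a‖ :=
  BoundedFunctions.norm_le (norm_nonneg a) fun g => (IsEquivariantUCP.of_hom e).norm_le a g

theorem projection_rangePullback (f : C(X, ℂ)) :
    projection e (rangePullback f) = rangePullback f := Hom.map_ι e f

theorem projection_rangePullback_mul (f : C(X, ℂ)) :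
    projection e (rangePullback f * a) = rangePullback f * projection e a :=
  BoundedFunctions.ext fun g => (IsEquivariantUCP.of_hom e).map_ι_mul f a g

theorem projection_mul_rangePullback (f : C(X, ℂ)) :
    projection e (a * rangePullback f) = projection e a * rangePullback f :=
  BoundedFunctions.ext fun g => (IsEquivariantUCP.of_hom e).map_mul_ι a f g

theorem projection_star_mul_self_nonneg : 0 ≤ projection e (star a * a) g :=
  (IsEquivariantUCP.of_hom e).nonneg a g

theorem star_projection_mul_projection_le :
    star (projection e a g) * projection e a g ≤ projection e (star a * a) g :=
  ((IsEquivariantUCP.of_hom e).isPositiveFunctional g).star_apply_mul_apply_le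
    ((IsEquivariantUCP.of_hom e).map_one g) a

variable {a} {g} in
theorem projection_star_mul_eq_zero (h : projection e (star a * a) g = 0) :
    projection e (star a * b) g = 0 :=
  ((IsEquivariantUCP.of_hom e).isPositiveFunctional g).apply_star_mul_eq_zero h b

variable {a} in
theorem projection_mem {γ : OpenBisection X} (ha : a ∈ hereditary rangePullback γ.supp) :
    projection e a ∈ hereditary rangePullback γ.supp := Hom.mem_hereditary e ha

variable {a} in
theorem projection_translate {γ : OpenBisection X} (ha : a ∈ hereditary rangePullback γ.supp) :
    projection e (translate γ a) = translate γ (projection e a) := by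
  have := Hom.map_act e (γ := γ) (a := a) ha
  rw [ellInfty_act ha] at this
  exact this.trans (ellInfty_act (projection_mem e ha))

end Projection

variable (X) in
/-- The idempotent `G`-ucp maps on `ℓ^∞(G)`. -/
def IdempotentHom : Type u := {e : ellInfty X ⟶ ellInfty X // e ≫ e = e}

namespace IdempotentHom

variable (p : IdempotentHom X)

/-- The underlying linear map. -/
def proj : BoundedFunctions X →ₗ[ℂ] BoundedFunctions X := projection p.1

theorem proj_proj (a : BoundedFunctions X) : p.proj (p.proj a) = p.proj a :=
  congrArg (fun φ : ellInfty X ⟶ ellInfty X => φ a) p.2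

/-- The range of an idempotent `G`-ucp map. -/
def fixed : Submodule ℂ (BoundedFunctions X) := LinearMap.ker (p.proj - LinearMap.id)

variable {p} in
theorem mem_fixed {a : BoundedFunctions X} : a ∈ p.fixed ↔ p.proj a = a := by
  rw [fixed, LinearMap.mem_ker, LinearMap.sub_apply, LinearMap.id_apply, sub_eq_zero]

theorem proj_mem_fixed (a : BoundedFunctions X) : p.proj a ∈ p.fixed :=
  mem_fixed.2 (p.proj_proj a)

theorem continuous_proj : Continuous p.proj :=
  AddMonoidHomClass.continuous_of_bound p.proj 1 fun a => by
    rw [one_mul]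
    exact norm_projection_le p.1 a

theorem isClosed_fixed : IsClosed (p.fixed : Set (BoundedFunctions X)) := by
  have : (p.fixed : Set (BoundedFunctions X)) = {a | p.proj a = a} := Set.ext fun _ => mem_fixed
  rw [this]
  exact isClosed_eq p.continuous_proj continuous_id

/-- `x⋆ x - e (x⋆ x)` annihilates everything under `e`, for `x` in the range of `e`. -/
theorem proj_proj_star_mul_self_mul {x : BoundedFunctions X} (hx : x ∈ p.fixed)
    (z : BoundedFunctions X) : p.proj (p.proj (star x * x) * z) = p.proj (star x * x * z) := by
  -- Kadison–Schwarz at the fixed point `x` gives `x⋆ x ≤ e (x⋆ x)`. The difference `c⋆ c` is killed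
  -- by the idempotent `e`, so `c` is a null vector at every arrow.
  obtain ⟨c, hc⟩ : ∃ c, p.proj (star x * x) - star x * x = star c * c := by
    refine BoundedFunctions.eq_star_mul_self fun g => ?_
    have := star_projection_mul_projection_le p.1 x g
    rw [show projection p.1 x = x from mem_fixed.1 hx] at this
    exact sub_nonneg.2 this
  rw [← sub_eq_zero, ← map_sub, ← sub_mul, hc, mul_assoc]
  refine BoundedFunctions.ext fun g => projection_star_mul_eq_zero p.1 _ ?_
  change p.proj (star c * c) g = 0
  rw [← hc, map_sub, proj_proj, sub_self]
  rfl

/-- Polarisation of the diagonal case. Associativity of the Choi–Effros product follows, both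
bracketings being `e (x y z)`. -/
theorem proj_proj_mul_mul {x y : BoundedFunctions X} (hx : x ∈ p.fixed) (hy : y ∈ p.fixed)
    (z : BoundedFunctions X) : p.proj (p.proj (x * y) * z) = p.proj (x * y * z) := by
  let D : p.fixed →ₗ⋆[ℂ] p.fixed →ₗ[ℂ] BoundedFunctions X := LinearMap.mk₂'ₛₗ _ _
    (fun x y => p.proj (p.proj (star x.1 * y.1) * z) - p.proj (star x.1 * y.1 * z))
    (by intros; simp [add_mul]; abel) (by intros; simp [smul_sub])
    (by intros; simp [mul_add, add_mul]; abel) (by intros; simp [smul_sub])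
  have hx' : star x ∈ p.fixed := by
    rw [mem_fixed, proj, projection_star]
    exact congrArg star (mem_fixed.1 hx)
  have := eq_zero_of_diagonal D (fun x => sub_eq_zero.2 (p.proj_proj_star_mul_self_mul x.2 z))
    ⟨star x, hx'⟩ ⟨y, hy⟩
  simpa [D, sub_eq_zero] using this

/-- The range of an idempotent `G`-ucp map on `ℓ^∞(G)`, with the Choi–Effros product
`x ∘ y = e (x y)`. -/
def Range : Type u := p.fixed

variable {p}

namespace Range

/-- The inclusion into the bounded functions. -/
def val (x : p.Range) : BoundedFunctions X := Subtype.val (p := (· ∈ p.fixed)) x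

theorem val_injective : Function.Injective (val : p.Range → BoundedFunctions X) :=
  Subtype.val_injective

/-- The projection of a bounded function. -/
def mk (p : IdempotentHom X) (a : BoundedFunctions X) : p.Range := ⟨p.proj a, p.proj_mem_fixed a⟩

theorem val_mk (a : BoundedFunctions X) : (mk p a).val = p.proj a := rfl

theorem val_mem (x : p.Range) : x.val ∈ p.fixed := x.2

@[simp] theorem proj_val (x : p.Range) : p.proj x.val = x.val := mem_fixed.1 x.2

instance : NormedAddCommGroup p.Range := inferInstanceAs (NormedAddCommGroup p.fixed)

instance : Module ℂ p.Range := inferInstanceAs (Module ℂ p.fixed)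

@[simp] theorem val_add (x y : p.Range) : (x + y).val = x.val + y.val := rfl
@[simp] theorem val_zero : (0 : p.Range).val = 0 := rfl
@[simp] theorem val_sub (x y : p.Range) : (x - y).val = x.val - y.val := rfl
@[simp] theorem val_smul (c : ℂ) (x : p.Range) : (c • x).val = c • x.val := rfl
theorem norm_val (x : p.Range) : ‖x.val‖ = ‖x‖ := rfl

instance : Mul p.Range := ⟨fun x y => mk p (x.val * y.val)⟩
instance : One p.Range := ⟨⟨1, mem_fixed.2 (projection_one p.1)⟩⟩
instance : Star p.Range := ⟨fun x => ⟨star x.val, mem_fixed.2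
  ((projection_star p.1 _).trans (congrArg star x.proj_val))⟩⟩

@[simp] theorem val_mul (x y : p.Range) : (x * y).val = p.proj (x.val * y.val) := rfl
@[simp] theorem val_one : (1 : p.Range).val = 1 := rfl
@[simp] theorem val_star (x : p.Range) : (star x).val = star x.val := rfl

theorem mul_comm' (x y : p.Range) : x * y = y * x :=
  val_injective (by rw [val_mul, val_mul, mul_comm])

instance : NormedCommRing p.Range :=
  { (inferInstance : NormedAddCommGroup p.Range) with
    mul := (· * ·)
    one := 1
    left_distrib := fun x y z => val_injective (by simp [mul_add])
    right_distrib := fun x y z => val_injective (by simp [add_mul])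
    zero_mul := fun x => val_injective (by simp)
    mul_zero := fun x => val_injective (by simp)
    mul_assoc := fun x y z => val_injective (by
      rw [val_mul, val_mul, val_mul, val_mul, p.proj_proj_mul_mul x.val_mem y.val_mem,
        mul_comm x.val (p.proj _), p.proj_proj_mul_mul y.val_mem z.val_mem]
      congr 1
      ring)
    one_mul := fun x => val_injective (by simp)
    mul_one := fun x => val_injective (by simp)
    mul_comm := mul_comm'
    norm_mul_le := fun x y => (norm_projection_le p.1 _).trans (norm_mul_le x.val y.val) }

instance : StarRing p.Range where
  star_involutive x := val_injective (by simp)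
  star_mul x y := val_injective (by
    simp only [val_star, val_mul]
    rw [← star_mul]
    exact (projection_star p.1 _).symm)
  star_add x y := val_injective (by simp)

instance : CompleteSpace p.Range :=
  p.isClosed_fixed.isComplete.completeSpace_coe

/-- Kadison–Schwarz gives `x⋆ x ≤ e (x⋆ x)` pointwise, hence `‖x‖² ≤ ‖e (x⋆ x)‖`. -/
instance : CStarRing p.Range where
  norm_mul_self_le x := by
    rw [← norm_val, ← norm_val, val_mul, val_star, ← CStarRing.norm_star_mul_self]
    refine BoundedFunctions.norm_le (norm_nonneg _) fun g => ?_
    refine le_trans ?_ ((p.proj (star x.val * x.val)).norm_apply_le g)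
    have h := star_projection_mul_projection_le p.1 x.val g
    rw [show projection p.1 x.val = x.val from x.proj_val] at h
    exact CStarAlgebra.norm_le_norm_of_nonneg_of_le (star_mul_self_nonneg (x.val g)) h

instance : Algebra ℂ p.Range := Algebra.ofModule
  (fun c x y => val_injective (by simp)) (fun c x y => val_injective (by simp))

instance : NormedAlgebra ℂ p.Range where
  norm_smul_le c x := (norm_smul_le c x.val)

instance : StarModule ℂ p.Range where
  star_smul c x := val_injective (by simp)

instance : CommCStarAlgebra p.Range where

end Range

end IdempotentHom

end GroupoidCStarAlgebra

/-! ### The range of an idempotent as a unital `G`-C⋆-algebra -/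

namespace GroupoidCStarAlgebra

variable {X : Type u} [Groupoid.{u} X] [TopologicalSpace X] [CompactSpace X] [T2Space X]
  [TopologicalSpace (Arr X)] [EtaleGroupoid X]

namespace IdempotentHom

namespace Range

variable {p : IdempotentHom X}

/-- The embedding of `C(X)`. -/
def ι (p : IdempotentHom X) : C(X, ℂ) →⋆ₐ[ℂ] p.Range where
  toFun f := ⟨rangePullback f, mem_fixed.2 (projection_rangePullback p.1 f)⟩
  map_one' := rfl
  map_mul' f f' := val_injective
    ((map_mul rangePullback f f').trans ((projection_rangePullback p.1 (f * f')).symm.trans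
      (congrArg _ (map_mul rangePullback f f'))))
  map_zero' := rfl
  map_add' _ _ := rfl
  commutes' c := by
    rw [Algebra.algebraMap_eq_smul_one, Algebra.algebraMap_eq_smul_one]
    rfl
  map_star' _ := rfl

@[simp] theorem val_ι (f : C(X, ℂ)) : (ι p f).val = rangePullback f := rfl

/-- By modularity of `e` over `C(X)`, the Choi–Effros product with functions from `C(X)` is the
pointwise one. Hence the hereditary subalgebras of the range are the traces of those of `ℓ^∞(G)`. -/
theorem val_ι_mul_mul_ι (f f' : C(X, ℂ)) (x : p.Range) :
    (ι p f * x * ι p f').val = rangePullback f * x.val * rangePullback f' := by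
  have h1 : p.proj (rangePullback f * x.val) = rangePullback f * x.val :=
    (projection_rangePullback_mul p.1 _ f).trans (congrArg _ x.proj_val)
  have h2 : p.proj (rangePullback f * x.val * rangePullback f') =
      rangePullback f * x.val * rangePullback f' :=
    (projection_mul_rangePullback p.1 _ f').trans (congrArg (· * _) h1)
  rw [val_mul, val_mul, val_ι, val_ι, h1, h2]

/-- The inclusion as a linear map. -/
def valₗ (p : IdempotentHom X) : p.Range →ₗ[ℂ] BoundedFunctions X where
  toFun := val
  map_add' _ _ := rfl
  map_smul' _ _ := rfl

/-- The projection as a linear map. -/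
def mkₗ (p : IdempotentHom X) : BoundedFunctions X →ₗ[ℂ] p.Range where
  toFun := mk p
  map_add' a b := val_injective (map_add p.proj a b)
  map_smul' c a := val_injective (map_smul p.proj c a)

theorem mk_val (x : p.Range) : mk p x.val = x := val_injective x.proj_val

theorem mem_hereditary_of_val_mem {U : Set X} {a : BoundedFunctions X}
    (ha : a ∈ hereditary rangePullback U) : mk p a ∈ hereditary (ι p) U := by
  refine hereditary_induction rangePullback U
    ((hereditary (ι p) U).toSubmodule.comap (mkₗ p)) ?_ ?_ ha
  · refine IsClosed.preimage (f := mkₗ p) ?_ isClosed_closure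
    refine AddMonoidHomClass.continuous_of_bound (mkₗ p) 1 fun a => ?_
    rw [one_mul]
    exact norm_projection_le p.1 a
  · intro f a f' hf hf'
    change mk p _ ∈ hereditary (ι p) U
    have : mk p (rangePullback f * a * rangePullback f') = ι p f * mk p a * ι p f' := by
      refine val_injective ?_
      rw [val_ι_mul_mul_ι, val_mk, val_mk]
      exact (projection_mul_rangePullback p.1 _ f').trans
        (congrArg (· * _) (projection_rangePullback_mul p.1 _ f))
    rw [this]
    exact gen_mem_hereditary _ hf hf' _

theorem mem_hereditary_iff {U : Set X} {x : p.Range} :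
    x ∈ hereditary (ι p) U ↔ x.val ∈ hereditary rangePullback U := by
  refine ⟨fun hx => ?_, fun hx => ?_⟩
  · refine hereditary_induction (ι p) U
      ((hereditary rangePullback U).toSubmodule.comap (valₗ p)) ?_ ?_ hx
    · refine IsClosed.preimage (f := valₗ p) ?_ isClosed_closure
      exact AddMonoidHomClass.continuous_of_bound (valₗ p) 1 fun a => (one_mul ‖a‖).ge
    · intro f a f' hf hf'
      change (ι p f * a * ι p f').val ∈ hereditary rangePullback U
      rw [val_ι_mul_mul_ι]
      exact gen_mem_hereditary _ hf hf' _
  · rw [← mk_val x]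
    exact mem_hereditary_of_val_mem hx

theorem translate_mem_fixed {γ : OpenBisection X} {a : BoundedFunctions X} (ha : a ∈ p.fixed)
    (h : a ∈ hereditary rangePullback γ.supp) : translate γ a ∈ p.fixed :=
  mem_fixed.2 ((projection_translate p.1 h).trans (congrArg _ (mem_fixed.1 ha)))

/-- The translate of an element of the range. -/
def translateRange (γ : OpenBisection X) (x : hereditary (ι p) γ.supp) : p.Range :=
  ⟨translate γ x.1.val, translate_mem_fixed x.1.val_mem (mem_hereditary_iff.1 x.2)⟩

theorem translateRange_mem (γ : OpenBisection X) (x : hereditary (ι p) γ.supp) :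
    translateRange γ x ∈ hereditary (ι p) γ.im :=
  mem_hereditary_iff.2 (translate_mem_im γ (mem_hereditary_iff.1 x.2))

/-- The action of `γ`. -/
def action (p : IdempotentHom X) (γ : OpenBisection X) : HereditaryEquiv (ι p) γ.supp γ.im where
  toFun x := ⟨translateRange γ x, translateRange_mem γ x⟩
  invFun x :=
    ⟨translateRange (star γ) ⟨x.1, by rw [γ.supp_star]; exact x.2⟩, by
      rw [← γ.im_star]
      exact translateRange_mem _ _⟩
  left_inv x := Subtype.ext (val_injective
    (translate_star_translate γ (mem_hereditary_iff.1 x.2)))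
  right_inv x := Subtype.ext (val_injective
    (translate_translate_star γ (mem_hereditary_iff.1 x.2)))
  -- Translation respects the new product because it is pointwise multiplicative and commutes with
  -- `e` on the hereditary subalgebra.
  map_mul' x y := Subtype.ext (val_injective (by
    change translate γ (p.proj (x.1.val * y.1.val)) =
      p.proj (translate γ x.1.val * translate γ y.1.val)
    rw [← translate_mul]
    exact (projection_translate p.1
      (mul_mem (mem_hereditary_iff.1 x.2) (mem_hereditary_iff.1 y.2))).symm))
  map_add' x y := Subtype.ext (val_injective (map_add (translate γ) _ _))
  map_star' x := Subtype.ext (val_injective (translate_star γ _))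
  map_smul' c x := Subtype.ext (val_injective (map_smul (translate γ) c _))

end Range

/-- The range of an idempotent as a unital `G`-C⋆-algebra. -/
def algebra (p : IdempotentHom X) : GroupoidCStarAlgebra X where
  carrier := p.Range
  ι := Range.ι p
  ι_injective f f' h := (ellInfty X).ι_injective (congrArg Range.val h)
  α := Range.action p
  α_ι γ f hf := Range.val_injective (translate_rangePullback γ f hf)
  α_mul γ₁ γ₂ a ha := by
    obtain ⟨h, e⟩ := (ellInfty X).α_mul γ₁ γ₂ a.val (Range.mem_hereditary_iff.1 ha)
    exact ⟨Range.mem_hereditary_iff.2 h, Range.val_injective e⟩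

variable (p : IdempotentHom X)

theorem algebra_mul_comm (a b : p.algebra) : a * b = b * a := Range.mul_comm' a b

theorem algebra_act {γ : OpenBisection X} {x : p.Range} (hx : x ∈ hereditary (Range.ι p) γ.supp) :
    Range.val (p.algebra.act γ x) = translate γ x.val :=
  congrArg Range.val (act_of_mem (A := p.algebra) hx)

/-- The inclusion of the range of `p` into `ℓ^∞(G)`. -/
def inclusion : p.algebra ⟶ ellInfty X :=
  Hom.ofCommute ellInfty_mul_comm (Range.valₗ p)
    (fun a => Hom.map_nonneg p.1 (star_mul_self_nonneg (R := ellInfty X) (Range.val a)))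
    (fun _ => rfl) (fun _ _ ha => Range.mem_hereditary_iff.1 ha)
    (fun _ _ ha => (p.algebra_act ha).trans (ellInfty_act (Range.mem_hereditary_iff.1 ha)).symm)

/-- The norm criterion with `t = ‖x‖`: pointwise `0 ≤ x g ≤ ‖x‖`, so `|‖x‖ - x g| ≤ ‖x‖`. -/
theorem nonneg_of_val {x : p.algebra} (h : ∀ g, 0 ≤ (Range.val x) g) : 0 ≤ x := by
  have hsa : IsSelfAdjoint x := Range.val_injective (BoundedFunctions.ext fun g =>
    (h g).isSelfAdjoint.star_eq)
  refine nonneg_of_norm_sub_le hsa (t := ‖x‖) ?_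
  refine BoundedFunctions.norm_le (norm_nonneg _) fun g => ?_
  have h1 : (Range.val (algebraMap ℝ p.algebra ‖x‖ - x)) g = (‖x‖ : ℂ) - (Range.val x) g := by
    rw [Algebra.algebraMap_eq_smul_one, ← Complex.coe_smul]
    change (‖x‖ : ℂ) * 1 - _ = _
    rw [mul_one]
    rfl
  have h2 : (Range.val x) g = (((Range.val x) g).re : ℂ) :=
    Complex.ext rfl (Complex.le_def.1 (h g)).2.symm
  have h3 := (Range.val x).norm_apply_le g
  have h4 := (Complex.le_def.1 (h g)).1
  have h5 : ‖Range.val x‖ = ‖x‖ := rfl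
  change ‖(Range.val (algebraMap ℝ p.algebra ‖x‖ - x)) g‖ ≤ _
  rw [h5, h2, Complex.norm_real, Real.norm_of_nonneg h4] at h3
  rw [h1, h2, ← Complex.ofReal_sub, Complex.norm_real, Real.norm_of_nonneg (by linarith)]
  simp only [Complex.zero_re] at h4
  linarith

/-- The projection of `ℓ^∞(G)` onto the range of `p`. -/
def retraction : ellInfty X ⟶ p.algebra :=
  Hom.ofCommute p.algebra_mul_comm (Range.mkₗ p)
    (fun a => p.nonneg_of_val fun g => projection_star_mul_self_nonneg p.1 a g)
    (fun f => Range.val_injective (projection_rangePullback p.1 f))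
    (fun _ _ ha => Range.mem_hereditary_of_val_mem ha)
    (fun γ a ha => by
      refine Range.val_injective ?_
      rw [ellInfty_act ha]
      exact (projection_translate p.1 ha).trans
        (p.algebra_act (Range.mem_hereditary_of_val_mem ha)).symm)

theorem inclusion_retraction : p.inclusion ≫ p.retraction = 𝟙 _ :=
  Hom.ext' fun x => Range.mk_val x

theorem retraction_inclusion : p.retraction ≫ p.inclusion = p.1 := rfl

end IdempotentHom

/-! ### Injective envelopes of `C(X)` -/

theorem IsInjective.of_retract {A C : GroupoidCStarAlgebra X} (hC : C.IsInjective) (i : A ⟶ C)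
    (r : C ⟶ A) (h : i ≫ r = 𝟙 A) : A.IsInjective := by
  intro B D j hj φ
  obtain ⟨ψ, hψ⟩ := hC B D j hj (φ ≫ i)
  exact ⟨ψ ≫ r, by rw [← Category.assoc, hψ, Category.assoc, h, Category.comp_id]⟩

theorem isCompleteOrderEmbedding_of_split {A B : GroupoidCStarAlgebra X} (φ : A ⟶ B) (ψ : B ⟶ A)
    (h : φ ≫ ψ = 𝟙 A) : IsCompleteOrderEmbedding φ := by
  intro k M
  refine ⟨fun hM => ?_, φ.map_cstarMatrix_nonneg⟩
  have := ψ.map_cstarMatrix_nonneg hM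
  have e : (M.map φ).map ψ = M := CStarMatrix.ext fun i j =>
    congrArg (fun χ : A ⟶ A => χ (M i j)) h
  rwa [e] at this

theorem hom_unitAlgebra_apply {A : GroupoidCStarAlgebra X} (i : unitAlgebra X ⟶ A)
    (f : C(X, ℂ)) : i f = A.ι f := Hom.map_ι i f

/-- `C(X)` is an initial object. -/
theorem hom_unitAlgebra_ext {A : GroupoidCStarAlgebra X} (i i' : unitAlgebra X ⟶ A) : i = i' :=
  Hom.ext' fun f => (hom_unitAlgebra_apply i f).trans (hom_unitAlgebra_apply i' f).symm

/-- An injective ⋆-homomorphism stays injective on matrices, and injective ⋆-homomorphisms reflect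
positivity. -/
theorem isCompleteOrderEmbedding_of_starAlgHom {A B : GroupoidCStarAlgebra X} (φ : A ⟶ B)
    (π : A →⋆ₐ[ℂ] B) (hπ : Function.Injective π) (h : ∀ a, φ a = π a) :
    IsCompleteOrderEmbedding φ := by
  intro k M
  refine ⟨fun hM => ?_, φ.map_cstarMatrix_nonneg⟩
  refine nonneg_of_forall_starAlgHom (I := Unit) (B := fun _ => CStarMatrix (Fin k) (Fin k) B)
    (fun _ => CStarMatrix.mapₙₐ π.toNonUnitalStarAlgHom) (fun N hN => ?_) fun _ => ?_
  · ext i j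
    refine hπ ?_
    rw [CStarMatrix.zero_apply, map_zero]
    exact congrFun (congrFun (hN ()) i) j
  · convert hM using 1
    ext i j
    exact (h _).symm

theorem isCompleteOrderEmbedding_unitAlgebra {A : GroupoidCStarAlgebra X}
    (i : unitAlgebra X ⟶ A) : IsCompleteOrderEmbedding i :=
  isCompleteOrderEmbedding_of_starAlgHom i A.ι A.ι_injective (hom_unitAlgebra_apply i)

/-- The unique morphism from `C(X)`. -/
def fromUnitAlgebra {A : GroupoidCStarAlgebra X} (hA : ∀ a b : A, a * b = b * a) :
    unitAlgebra X ⟶ A :=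
  Hom.ofCommute hA A.ι.toAlgHom.toLinearMap
    (fun f => by
      change 0 ≤ A.ι (star (show C(X, ℂ) from f) * (show C(X, ℂ) from f))
      rw [map_mul, map_star]
      exact star_mul_self_nonneg _)
    (fun _ => rfl)
    (fun _ _ hf => mem_hereditary A.ι (mem_hereditary_id.1 hf))
    (fun γ f hf => by
      have h := mem_hereditary_id.1 hf
      rw [act_of_mem (A := unitAlgebra X) hf]
      exact (act_ι h).symm)

theorem IsInjective.exists_hom {C : GroupoidCStarAlgebra X} (hC : C.IsInjective)
    {A : GroupoidCStarAlgebra X} (i : unitAlgebra X ⟶ A) (j : unitAlgebra X ⟶ C) :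
    Nonempty (A ⟶ C) :=
  let ⟨ψ, _⟩ := hC _ _ i (isCompleteOrderEmbedding_unitAlgebra i) j
  ⟨ψ⟩

theorem IsCompleteOrderEmbedding.injective {A B : GroupoidCStarAlgebra X} {φ : A ⟶ B}
    (h : IsCompleteOrderEmbedding φ) : Function.Injective φ := by
  intro a b hab
  have hz {c : A} (hc : φ c = 0) : c = 0 := by
    refine le_antisymm (neg_nonneg.1 ((h.nonneg_iff _).1 ?_)) ((h.nonneg_iff _).1 hc.ge)
    rw [← neg_one_smul ℂ c, φ.map_smul, hc, smul_zero]
  refine sub_eq_zero.1 (hz ?_)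
  rw [sub_eq_add_neg, ← neg_one_smul ℂ b, φ.map_add, φ.map_smul, hab, neg_one_smul,
    add_neg_cancel]

variable (X) in
/-- There is a commutative injective unital `G`-C⋆-algebra without nontrivial endomorphisms. -/
theorem exists_injective_rigid : ∃ E : GroupoidCStarAlgebra X,
    E.IsInjective ∧ (∀ φ : E ⟶ E, φ = 𝟙 E) ∧ ∀ a b : E, a * b = b * a := by
  obtain ⟨e, he⟩ := exists_minimal_idempotent (X := X)
  let p : IdempotentHom X := ⟨e, by simpa using he (𝟙 _)⟩
  have hp := p.inclusion_retraction
  refine ⟨p.algebra, isInjective_ellInfty.of_retract p.inclusion p.retraction hp, fun φ => ?_,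
    p.algebra_mul_comm⟩
  -- An endomorphism of the range becomes one of `ℓ^∞(G)`. Compressing `e s e = e` to the range
  -- leaves `φ = 𝟙`.
  have h := he (p.retraction ≫ φ ≫ p.inclusion)
  rw [← show p.retraction ≫ p.inclusion = e from p.retraction_inclusion] at h
  have h' := congrArg (fun ψ => p.inclusion ≫ ψ ≫ p.retraction) h
  simpa [hp, reassoc_of% hp] using h'

section Envelope

variable {E : GroupoidCStarAlgebra X}

/-- Injectivity provides a map back from `C`. The composite is an endomorphism of `E`, hence the
identity, so `φ` is split and therefore an embedding. -/
theorem isInjectiveEnvelope_of_rigid (hE : E.IsInjective) (hr : ∀ φ : E ⟶ E, φ = 𝟙 E)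
    (i : unitAlgebra X ⟶ E) : IsInjectiveEnvelope i := by
  refine ⟨hE, isCompleteOrderEmbedding_unitAlgebra i, fun C φ _ => ?_⟩
  obtain ⟨ψ⟩ := hE.exists_hom (i ≫ φ) i
  exact isCompleteOrderEmbedding_of_split φ ψ (hr _)

/-- Injectivity gives `φ` and `ψ` with `φ ≫ ψ = 𝟙 E`. Essentiality of `i'` makes `ψ` injective, and
cancelling it in `ψ ≫ φ ≫ ψ = ψ` gives the other identity. -/
theorem IsInjectiveEnvelope.nonempty_iso {E' : GroupoidCStarAlgebra X} (hE : E.IsInjective)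
    (hr : ∀ φ : E ⟶ E, φ = 𝟙 E) (i : unitAlgebra X ⟶ E) {i' : unitAlgebra X ⟶ E'}
    (h : IsInjectiveEnvelope i') : Nonempty (E ≅ E') := by
  obtain ⟨φ⟩ := h.1.exists_hom i i'
  obtain ⟨ψ⟩ := hE.exists_hom i' i
  have hψ : IsCompleteOrderEmbedding ψ :=
    h.2.2 _ ψ (isCompleteOrderEmbedding_unitAlgebra _)
  refine ⟨⟨φ, ψ, hr _, Hom.ext' fun a => hψ.injective ?_⟩⟩
  exact congrArg (fun χ : E ⟶ E => χ (ψ a)) (hr (φ ≫ ψ))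

/-- Isomorphisms of unital `G`-C⋆-algebras are ⋆-isomorphisms. -/
def starAlgEquivOfIso {E' : GroupoidCStarAlgebra X} (φ : E ≅ E') : E ≃⋆ₐ[ℂ] E' where
  toFun := φ.hom
  invFun := φ.inv
  left_inv a := congrArg (fun χ : E ⟶ E => χ a) φ.hom_inv_id
  right_inv a := congrArg (fun χ : E' ⟶ E' => χ a) φ.inv_hom_id
  map_mul' := (Hom.cp φ.hom).apply_mul_of_inverse (Hom.cp φ.inv) (Hom.map_one _) (Hom.map_one _)
    (fun a => congrArg (fun χ : E ⟶ E => χ a) φ.hom_inv_id)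
    (fun a => congrArg (fun χ : E' ⟶ E' => χ a) φ.inv_hom_id)
  map_add' := Hom.map_add φ.hom
  map_star' := Hom.map_star φ.hom
  map_smul' := Hom.map_smul φ.hom

end Envelope

end GroupoidCStarAlgebra

/-! ### Spectra of commutative C⋆-algebras. -/

section Spectrum

open WeakDual

theorem compactSpace_characterSpace {E : Type*} [CStarAlgebra E] (hE : ∀ a b : E, a * b = b * a) :
    CompactSpace (characterSpace ℂ E) :=
  let _ : CommCStarAlgebra E := { (inferInstance : CStarAlgebra E) with mul_comm := hE }
  inferInstance

theorem nonempty_starAlgEquiv_characterSpace {E : Type*} [CStarAlgebra E]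
    (hE : ∀ a b : E, a * b = b * a) : Nonempty (E ≃⋆ₐ[ℂ] C(characterSpace ℂ E, ℂ)) :=
  let _ : CommCStarAlgebra E := { (inferInstance : CStarAlgebra E) with mul_comm := hE }
  ⟨gelfandStarTransform E⟩

/-- Isomorphic C⋆-algebras have homeomorphic character spaces. -/
def characterSpaceHomeomorph {E E' : Type*} [CStarAlgebra E] [CStarAlgebra E'] (e : E ≃⋆ₐ[ℂ] E') :
    characterSpace ℂ E ≃ₜ characterSpace ℂ E' where
  toFun := CharacterSpace.compContinuousMap (e.symm : E' →⋆ₐ[ℂ] E)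
  invFun := CharacterSpace.compContinuousMap (e : E →⋆ₐ[ℂ] E')
  left_inv χ := Subtype.ext (ContinuousLinearMap.ext fun a => congrArg χ (e.symm_apply_apply a))
  right_inv χ := Subtype.ext (ContinuousLinearMap.ext fun a => congrArg χ (e.apply_symm_apply a))
  continuous_toFun := ContinuousMap.continuous _
  continuous_invFun := ContinuousMap.continuous _

end Spectrum

end

theorem mainTheorem8 (X : Type u) [Groupoid.{u} X] [TopologicalSpace X] [CompactSpace X]
    [T2Space X] [TopologicalSpace (Arr X)] [EtaleGroupoid X] :
    -- `ℓ^∞(G)` is injective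
    (GroupoidCStarAlgebra.ellInfty X).IsInjective ∧
    -- `C(X)` has an injective envelope
    (∃ (E : GroupoidCStarAlgebra X) (i : GroupoidCStarAlgebra.unitAlgebra X ⟶ E),
      GroupoidCStarAlgebra.IsInjectiveEnvelope i) ∧
    -- every injective envelope of `C(X)` is rigid and commutative
    (∀ (E : GroupoidCStarAlgebra X) (i : GroupoidCStarAlgebra.unitAlgebra X ⟶ E),
      GroupoidCStarAlgebra.IsInjectiveEnvelope i →
        GroupoidCStarAlgebra.IsRigid i ∧ ∀ a b : E, a * b = b * a) ∧
    -- any two are isomorphic under `C(X)`, by a `⋆`-isomorphism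
    (∀ (E E' : GroupoidCStarAlgebra X) (i : GroupoidCStarAlgebra.unitAlgebra X ⟶ E)
      (i' : GroupoidCStarAlgebra.unitAlgebra X ⟶ E'),
      GroupoidCStarAlgebra.IsInjectiveEnvelope i → GroupoidCStarAlgebra.IsInjectiveEnvelope i' →
        ∃ (φ : E ≅ E') (e : E ≃⋆ₐ[ℂ] E'), i ≫ φ.hom = i' ∧ ∀ a : E, φ.hom a = e a) ∧
    -- the Hamana boundary exists, is unique up to homeomorphism, is compact Hausdorff, and its
    -- algebra of continuous functions is the injective envelope
    (∃ (Y : Type u) (_ : TopologicalSpace Y), GroupoidCStarAlgebra.IsHamanaBoundary X Y) ∧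
    (∀ (Y : Type u) [TopologicalSpace Y], GroupoidCStarAlgebra.IsHamanaBoundary X Y →
      CompactSpace Y ∧ T2Space Y ∧
        ∀ (E : GroupoidCStarAlgebra X) (i : GroupoidCStarAlgebra.unitAlgebra X ⟶ E),
          GroupoidCStarAlgebra.IsInjectiveEnvelope i → Nonempty (E ≃⋆ₐ[ℂ] C(Y, ℂ))) ∧
    (∀ (Y Y' : Type u) [TopologicalSpace Y] [TopologicalSpace Y'],
      GroupoidCStarAlgebra.IsHamanaBoundary X Y → GroupoidCStarAlgebra.IsHamanaBoundary X Y' →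
        Nonempty (Y ≃ₜ Y')) := by
  obtain ⟨E, hE, hr, hc⟩ := GroupoidCStarAlgebra.exists_injective_rigid X
  let i := GroupoidCStarAlgebra.fromUnitAlgebra hc
  have hi := GroupoidCStarAlgebra.isInjectiveEnvelope_of_rigid hE hr i
  have key (E' : GroupoidCStarAlgebra X) (i' : GroupoidCStarAlgebra.unitAlgebra X ⟶ E')
      (h : GroupoidCStarAlgebra.IsInjectiveEnvelope i') : Nonempty (E ≅ E') :=
    h.nonempty_iso hE hr i
  have hcomm (E' : GroupoidCStarAlgebra X) (i' : GroupoidCStarAlgebra.unitAlgebra X ⟶ E')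
      (h : GroupoidCStarAlgebra.IsInjectiveEnvelope i') (a b : E') : a * b = b * a := by
    obtain ⟨φ⟩ := key E' i' h
    let e := GroupoidCStarAlgebra.starAlgEquivOfIso φ
    apply e.symm.injective
    rw [map_mul, map_mul, hc]
  refine ⟨GroupoidCStarAlgebra.isInjective_ellInfty, ⟨E, i, hi⟩, fun E' i' h => ⟨⟨h.2.1, ?_⟩,
    hcomm E' i' h⟩, fun E' E'' i' i'' h' h'' => ?_,
    ⟨WeakDual.characterSpace ℂ E, inferInstance, E, i, hi, ⟨.refl _⟩⟩, ?_, ?_⟩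
  · intro φ _
    obtain ⟨θ⟩ := key E' i' h
    -- Rigidity is transported by conjugating the endomorphism of `E'` to one of `E`.
    have := congrArg (fun χ => θ.inv ≫ χ ≫ θ.hom) (hr (θ.hom ≫ φ ≫ θ.inv))
    simpa using this
  · obtain ⟨θ'⟩ := key E' i' h'
    obtain ⟨θ''⟩ := key E'' i'' h''
    exact ⟨θ'.symm ≪≫ θ'', GroupoidCStarAlgebra.starAlgEquivOfIso (θ'.symm ≪≫ θ''),
      -- The triangle under `C(X)` commutes because `C(X)` is initial.
      GroupoidCStarAlgebra.hom_unitAlgebra_ext _ _, fun _ => rfl⟩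
  · rintro Y _ ⟨E', i', h', ⟨y⟩⟩
    have := compactSpace_characterSpace (hcomm E' i' h')
    refine ⟨y.symm.compactSpace, y.symm.t2Space, fun E'' i'' h'' => ?_⟩
    obtain ⟨θ'⟩ := key E' i' h'
    obtain ⟨θ''⟩ := key E'' i'' h''
    obtain ⟨e⟩ := nonempty_starAlgEquiv_characterSpace (hcomm E' i' h')
    exact ⟨((GroupoidCStarAlgebra.starAlgEquivOfIso (θ''.symm ≪≫ θ')).trans e).trans
      (y.symm.compStarAlgEquiv' ℂ ℂ).symm⟩
  · rintro Y Y' _ _ ⟨E', i', h', ⟨y⟩⟩ ⟨E'', i'', h'', ⟨y'⟩⟩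
    obtain ⟨θ'⟩ := key E' i' h'
    obtain ⟨θ''⟩ := key E'' i'' h''
    exact ⟨(y.trans (characterSpaceHomeomorph
      (GroupoidCStarAlgebra.starAlgEquivOfIso (θ'.symm ≪≫ θ'')))).trans y'.symm⟩
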